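/- Let $d\in\{2,3\}$, let $D=\mathbb{T}^d=[-\pi,\pi]^d$ with endpoints identified, let $L^2_x=L^2(D;\mathbb{R}^d)$, and let $T>0$. Write $\mathcal{P}(X)$ for the set of Borel probability measures on $X$. For $\mu,\nu\in\mathcal{P}(L^2_x)$ let $\Pi(\mu,\nu)$ be the set of transport plans from $\mu$ to $\nu$, i.e. of $\pi\in\mathcal{P}(L^2_x\times L^2_x)$ with marginals $\mu$ and $\nu$, and let $W_1(\mu,\nu)=\inf_{\pi\in\Pi(\mu,\nu)}\int\Vert u-v\Vert_{L^2_x}\,d\pi(u,v)$. Let $L^1_t(\mathcal{P})$ be the space of maps $t\mapsto\mu_t$ from $[0,T)$ to $\mathcal{P}(L^2_x)$, identified when they agree for a.e. $t$, that are weak-$*$ measurable ($t\mapsto\int F\,d\mu_t$ is Lebesgue measurable for every bounded continuous $F:L^2_x\to\mathbb{R}$) and satisfy $\int_0^T\int\Vert u\Vert_{L^2_x}\,d\mu_t(u)\,dt<\infty$, with the metric $d_T(\mu_t,\nu_t)=\int_0^TW_1(\mu_t,\nu_t)\,dt$. For $L>0$ and $u\in L^2_x$ put $\Vert u\Vert_{H^{-L}_x}^2=(2\pi)^d\sum_{k\in\mathbb{Z}^d}(1+|k|^2)^{-L}|\widehat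 u(k)|^2$, where $\widehat u(k)=(2\pi)^{-d}\int_Du(x)e^{-ik\cdot x}\,dx$. A family $\{\mu^\Delta_t\}_{\Delta>0}\subset L^1_t(\mathcal{P})$ is called uniformly time-regular if there are constants $L,C>0$, independent of $\Delta$, and for each $\Delta>0$ a map $(s,t)\mapsto\pi^\Delta_{s,t}\in\mathcal{P}(L^2_x\times L^2_x)$ such that, for almost all $(s,t)\in[0,T)^2$, $\pi^\Delta_{s,t}$ is a transport plan from $\mu^\Delta_s$ to $\mu^\Delta_t$ and $$\int_{L^2_x\times L^2_x}\Vert u-v\Vert_{H^{-L}_x}\,d\pi^\Delta_{s,t}(u,v)\le C|t-s|.$$ The time-averaged structure function is $$S^2_r(\mu_t,T)=\left(\int_0^T\int_{L^2_x}\int_D\frac{1}{|B_r(0)|}\int_{B_r(0)}|u(x+h)-u(x)|^2\,dh\,dx\,d\mu_t(u)\,dt\right)^{1/2},\qquad r>0,$$ with $B_r(0)=\{h\in\mathbb{R}^d:|h|<r\}$. **Theorem.** Let $\{\mu^\Delta_t\}_{\Delta>0}\subset L^1_t(\mathcal{P})$ be a uniformly time-regular family. Assume that there is $M>0$ with $\mu^\Delta_t(\{u\in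 L^2_x:\Vert u\Vert_{L^2_x}<M\})=1$ for all $\Delta>0$ and a.e. $t\in[0,T)$, and that there is a modulus of continuity $\omega$, i.e. a map $\omega:[0,\infty)\to[0,\infty)$ with $\lim_{r\to0}\omega(r)=0$, such that $$S^2_r(\mu^\Delta_t,T)\le\omega(r)\qquad\text{for all }\Delta>0\text{ and all }r>0.$$ Then $\{\mu^\Delta_t\}_{\Delta>0}$ is relatively compact in $(L^1_t(\mathcal{P}),d_T)$, i.e. its closure is compact. -/

import Mathlib

open MeasureTheory Filter Topology Set
open scoped ENNReal NNReal BoundedContinuousFunction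

noncomputable section

namespace StatSol

instance factTwoPiPos : Fact (0 < 2 * Real.pi) := ⟨Real.two_pi_pos⟩

/-- The torus `[-π, π]^d` with endpoints identified, with its Lebesgue (Haar) measure of total
mass `(2π)^d`. -/
abbrev Torus (d : ℕ) : Type := Fin d → AddCircle (2 * Real.pi)

/-- The space `ℝ^d` with the Euclidean norm. -/
abbrev Phase (d : ℕ) : Type := EuclideanSpace ℝ (Fin d)

/-- The space `L²(D; ℝ^d)`, `D` the torus. -/
abbrev L2x (d : ℕ) : Type := Lp (Phase d) 2 (volume : Measure (Torus d))

instance measurableSpaceL2x (d : ℕ) : MeasurableSpace (L2x d) := borel _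

instance borelSpaceL2x (d : ℕ) : BorelSpace (L2x d) := ⟨rfl⟩

/-- The class modulo `2π` of a vector of `ℝ^d`. -/
def toTorus {d : ℕ} (h : Phase d) : Torus d := fun i => ((h i : ℝ) : AddCircle (2 * Real.pi))

/-- The `j`-th component of the Fourier coefficient
`û(k) = (2π)^{-d} ∫_D u(x) e^{-i k·x} dx`, `k ∈ ℤ^d`. -/
def fourierCoef {d : ℕ} (u : L2x d) (k : Fin d → ℤ) (j : Fin d) : ℂ :=
  (((2 * Real.pi) ^ d)⁻¹ : ℝ) •
    ∫ x : Torus d, (∏ i, fourier (-(k i)) (x i)) * ((u x j : ℝ) : ℂ)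

/-- The norm of the Sobolev space `H^{-L}(D; ℝ^d)`, restricted to `L²(D; ℝ^d)`:
`‖u‖² = (2π)^d ∑_k (1 + |k|²)^{-L} |û(k)|²`. -/
def negSobolevNorm {d : ℕ} (L : ℝ) (u : L2x d) : ℝ≥0∞ :=
  (ENNReal.ofReal ((2 * Real.pi) ^ d) *
    ∑' k : Fin d → ℤ, ENNReal.ofReal ((1 + ∑ i, (k i : ℝ) ^ 2) ^ (-L)) *
      ∑ j, ‖fourierCoef u k j‖ₑ ^ 2) ^ (1 / 2 : ℝ)

/-- `π` is a transfer plan (transport plan) from `μ` to `ν`: its marginals are `μ` and `ν`. -/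
def IsTransferPlan {X : Type*} [MeasurableSpace X] (π : ProbabilityMeasure (X × X))
    (μ ν : ProbabilityMeasure X) : Prop :=
  (π : Measure (X × X)).map Prod.fst = (μ : Measure X) ∧
    (π : Measure (X × X)).map Prod.snd = (ν : Measure X)

/-- The `1`-Wasserstein distance `W₁`. -/
def wasserstein1 {X : Type*} [NormedAddCommGroup X] [MeasurableSpace X]
    (μ ν : ProbabilityMeasure X) : ℝ≥0∞ :=
  ⨅ (π : ProbabilityMeasure (X × X)) (_ : IsTransferPlan π μ ν),
    ∫⁻ p, ‖p.1 - p.2‖ₑ ∂(π : Measure (X × X))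

/-- Lebesgue measure on the time interval `[0, T)`. -/
def timeMeasure (T : ℝ) : Measure ℝ := volume.restrict (Ico 0 T)

/-- Weak-`*` measurable maps `t ↦ μ_t` from `[0, T)` to the probability measures on `L²_x` with
`∫_0^T ∫ ‖u‖ dμ_t(u) dt < ∞`, as maps that are defined pointwise; the values at times outside
`[0, T)` play no role. -/
structure TimeParamMeasure (d : ℕ) (T : ℝ) where
  /-- the measure `μ_t` at time `t` -/
  at_time : ℝ → ProbabilityMeasure (L2x d)
  weakStar_measurable : ∀ F : L2x d →ᵇ ℝ,
    AEMeasurable (fun t => ∫ u, F u ∂(at_time t : Measure (L2x d))) (timeMeasure T)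
  integrable : ∫⁻ t, ∫⁻ u, ‖u‖ₑ ∂(at_time t : Measure (L2x d)) ∂(timeMeasure T) < ∞

/-- Equality at almost every time in `[0, T)`. -/
instance timeParamSetoid (d : ℕ) (T : ℝ) : Setoid (TimeParamMeasure d T) where
  r μ ν := μ.at_time =ᵐ[timeMeasure T] ν.at_time
  iseqv := ⟨fun _ => Filter.EventuallyEq.rfl, fun h => h.symm, fun h₁ h₂ => h₁.trans h₂⟩

/-- The space `L¹_t(P) = L¹([0, T); P(L²_x))`. -/
def L1P (d : ℕ) (T : ℝ) : Type := Quotient (timeParamSetoid d T)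

/-- The element of `L¹_t(P)` represented by a pointwise defined map. -/
def TimeParamMeasure.toL1P {d : ℕ} {T : ℝ} (μ : TimeParamMeasure d T) : L1P d T :=
  Quotient.mk (timeParamSetoid d T) μ

/-- The metric `d_T(μ, ν) = ∫_0^T W₁(μ_t, ν_t) dt` on `L¹_t(P)`. -/
def distT {d : ℕ} {T : ℝ} : L1P d T → L1P d T → ℝ≥0∞ :=
  Quotient.lift₂
    (fun μ ν => ∫⁻ t, wasserstein1 (μ.at_time t) (ν.at_time t) ∂(timeMeasure T))
    (by
      intro μ ν μ' ν' hμ hν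
      have h₁ : μ.at_time =ᵐ[timeMeasure T] μ'.at_time := hμ
      have h₂ : ν.at_time =ᵐ[timeMeasure T] ν'.at_time := hν
      refine lintegral_congr_ae ?_
      filter_upwards [h₁, h₂] with t ht₁ ht₂
      rw [ht₁, ht₂])

/-- The topology of the metric `d_T`: a set is open when it contains a `d_T`-ball around each of
its points. -/
instance topologicalSpaceL1P (d : ℕ) (T : ℝ) : TopologicalSpace (L1P d T) where
  IsOpen U := ∀ μ ∈ U, ∃ ε : ℝ≥0∞, 0 < ε ∧ ∀ ν, distT μ ν < ε → ν ∈ U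
  isOpen_univ := fun _ _ => ⟨1, one_pos, fun _ _ => mem_univ _⟩
  isOpen_inter := by
    rintro U V hU hV μ ⟨hμU, hμV⟩
    obtain ⟨ε₁, h₁, hb₁⟩ := hU μ hμU
    obtain ⟨ε₂, h₂, hb₂⟩ := hV μ hμV
    exact ⟨min ε₁ ε₂, lt_min h₁ h₂, fun ν hν =>
      ⟨hb₁ ν (hν.trans_le (min_le_left _ _)), hb₂ ν (hν.trans_le (min_le_right _ _))⟩⟩
  isOpen_sUnion := by
    rintro S hS μ ⟨U, hUS, hμU⟩
    obtain ⟨ε, hε, hb⟩ := hS U hUS μ hμU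
    exact ⟨ε, hε, fun ν hν => ⟨U, hUS, hb ν hν⟩⟩

/-- A set is relatively compact when its closure is compact. -/
def RelativelyCompact {X : Type*} [TopologicalSpace X] (K : Set X) : Prop :=
  IsCompact (closure K)

/-- The map `t ↦ μ_t` is time-regular with constants `L`, `C`. -/
def IsTimeRegularWith {d : ℕ} {T : ℝ} (μ : TimeParamMeasure d T) (L C : ℝ) : Prop :=
  ∃ π : ℝ → ℝ → ProbabilityMeasure (L2x d × L2x d),
    ∀ᵐ p : ℝ × ℝ ∂((timeMeasure T).prod (timeMeasure T)),
      IsTransferPlan (π p.1 p.2) (μ.at_time p.1) (μ.at_time p.2) ∧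
        ∫⁻ q, negSobolevNorm L (q.1 - q.2) ∂(π p.1 p.2 : Measure (L2x d × L2x d)) ≤
          ENNReal.ofReal (C * |p.2 - p.1|)

/-- The family `μ^Δ` is uniformly time-regular: each `μ^Δ` is time-regular, with constants `L` and
`C` that do not depend on `Δ`. -/
def UniformlyTimeRegular {ι : Type*} {d : ℕ} {T : ℝ} (μ : ι → TimeParamMeasure d T) : Prop :=
  ∃ L C : ℝ, 0 < L ∧ 0 < C ∧ ∀ Δ, IsTimeRegularWith (μ Δ) L C

/-- The spatial quantity `∫_D ⨍_{|h| < r} |u(x+h) - u(x)|² dh dx`. -/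
def meanSquareIncrement {d : ℕ} (r : ℝ) (u : L2x d) : ℝ≥0∞ :=
  ∫⁻ x : Torus d,
    (⨍⁻ h in Metric.ball (0 : Phase d) r, ‖u (x + toTorus h) - u x‖ₑ ^ 2 ∂volume)

/-- The time-averaged structure function `S²_r(μ_t, T)`, the square root of
`∫_0^T ∫ ∫_D ⨍_{|h| < r} |u(x+h) - u(x)|² dh dx dμ_t(u) dt`. -/
def structureFunction {d : ℕ} {T : ℝ} (μ : TimeParamMeasure d T) (r : ℝ) : ℝ≥0∞ :=
  (∫⁻ t, (∫⁻ u, meanSquareIncrement r u ∂(μ.at_time t : Measure (L2x d)))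
    ∂(timeMeasure T)) ^ (1 / 2 : ℝ)

/-- A modulus of continuity is a map `ω : [0, ∞) → [0, ∞)` with `lim_{r → 0} ω(r) = 0`. -/
def IsModulusOfContinuity (ω : ℝ≥0 → ℝ≥0) : Prop :=
  Tendsto ω (𝓝[≠] 0) (𝓝 0)

end StatSol

end

open StatSol

/-!
The closure of the family is compact because `L¹_t(P)` with the distance `d_T` is a complete
pseudometric space and the family is totally bounded in it.

**The space.** `W₁` satisfies the triangle inequality (two transport plans are glued along their
common marginal by disintegration, `wasserstein1_triangle`) and is complete: almost optimal plans
between consecutive laws are the transitions of a Markov chain, which converges almost surely when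
the distances are summable (`exists_tendsto_wasserstein1`). Laws with finitely many fixed atoms
depend continuously on their weights (`continuous_discreteLaw`). Since every law with a first moment
is a limit of such laws, `t ↦ W₁(μ_t, ν_t)` is measurable (`aemeasurable_wasserstein1`). Hence `d_T`
inherits the triangle inequality, and it inherits completeness by passing to rapidly converging
sequences, for which the distances are summable at almost every time.

**Smoothing.** A bound for the mean square increment of `u` over a ball of radius `r` bounds each
increment of length less than `r / 2` (`squareIncrement_le_meanSquareIncrement`), hence the distance
from `u` to its convolution with a bump function supported in the ball of radius `r / 2`
(`enorm_sub_smoothOp_sq_le`). Replacing the bump function by a uniformly close trigonometric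
polynomial costs little on bounded sets, and makes the convolution a function of finitely many
Fourier coefficients. The resulting operator `F` maps balls to totally bounded sets and satisfies
`‖F u‖ ≤ C ‖u‖_{H^{-L}}` (`exists_smoothing`). By the hypothesis on the structure functions, a
single `F` moves every member of the family by little in `d_T` (`exists_uniform_smoothing`).

**Total boundedness.** The push-forwards of `μ_s` and `μ_t` under `F` are at distance at most
`C |t - s|` in `W₁`, by time-regularity. So up to a small error a member of the family is described
by the law of `F` at finitely many times, and, since `F` has totally bounded values on the ball that
carries all the measures, by finitely many weights at each of these times
(`totallyBounded_range_toL1P`).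
-/

namespace StatSol

/-! ### The distance `W₁`: triangle inequality and completeness -/

section Wasserstein

/-- If `ω` has law `Q` and the next position is drawn from `κ (g ω)`, then `g ω` together with the
next position has law `(Q.map g) ⊗ κ`: the transition sees `ω` only through `g ω`. -/
theorem map_compProd_comap {X Ω : Type*} [MeasurableSpace X] [MeasurableSpace Ω] (Q : Measure Ω)
    [IsProbabilityMeasure Q] {g : Ω → X} (hg : Measurable g)
    (κ : ProbabilityTheory.Kernel X X) [ProbabilityTheory.IsMarkovKernel κ] :
    (Q.compProd (κ.comap g hg)).map (fun p => (g p.1, p.2)) = (Q.map g).compProd κ := by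
  have : IsProbabilityMeasure (Q.map g) := Measure.isProbabilityMeasure_map hg.aemeasurable
  refine Measure.ext_of_lintegral _ fun f hf => ?_
  rw [lintegral_map hf (by fun_prop), Measure.lintegral_compProd (by fun_prop),
    Measure.lintegral_compProd hf, lintegral_map (by fun_prop) hg]
  rfl

variable {X : Type*} [NormedAddCommGroup X] [MeasurableSpace X] [BorelSpace X]
  [SecondCountableTopology X]

/-- Every pair of random variables with laws `μ` and `ν` gives an upper bound for `W₁(μ, ν)`. -/
theorem wasserstein1_le_lintegral {Ω : Type*} [MeasurableSpace Ω] (P : Measure Ω)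
    [IsProbabilityMeasure P] {f g : Ω → X} (hf : Measurable f) (hg : Measurable g)
    {μ ν : ProbabilityMeasure X} (hμ : P.map f = μ) (hν : P.map g = ν) :
    wasserstein1 μ ν ≤ ∫⁻ ω, ‖f ω - g ω‖ₑ ∂P := by
  have hfg : Measurable fun ω => (f ω, g ω) := hf.prodMk hg
  let π : ProbabilityMeasure (X × X) :=
    ⟨P.map fun ω => (f ω, g ω), Measure.isProbabilityMeasure_map hfg.aemeasurable⟩
  have hπ : IsTransferPlan π μ ν := by
    constructor
    · rw [← hμ]; exact Measure.map_map measurable_fst hfg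
    · rw [← hν]; exact Measure.map_map measurable_snd hfg
  refine (iInf₂_le π hπ).trans_eq ?_
  exact lintegral_map (f := fun p : X × X => ‖p.1 - p.2‖ₑ) (by fun_prop) hfg

theorem wasserstein1_self (μ : ProbabilityMeasure X) : wasserstein1 μ μ = 0 := by
  have h := wasserstein1_le_lintegral (μ : Measure X) measurable_id measurable_id
    (Measure.map_id (μ := (μ : Measure X))) (Measure.map_id (μ := (μ : Measure X)))
  simpa using h

theorem wasserstein1_comm (μ ν : ProbabilityMeasure X) :
    wasserstein1 μ ν = wasserstein1 ν μ := by
  have key : ∀ μ ν : ProbabilityMeasure X, wasserstein1 μ ν ≤ wasserstein1 ν μ := by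
    intro μ ν
    refine le_iInf₂ fun π hπ => ?_
    refine (wasserstein1_le_lintegral (π : Measure (X × X)) measurable_snd measurable_fst
      hπ.2 hπ.1).trans_eq ?_
    exact lintegral_congr fun p => by rw [← enorm_neg, neg_sub]
  exact le_antisymm (key μ ν) (key ν μ)

/-- If two laws have a common part, only the remainders have to be transported. -/
theorem wasserstein1_le_of_common_part {m a b : Measure X} [IsFiniteMeasure a] [IsFiniteMeasure b]
    (hab : a univ = b univ) {μ ν : ProbabilityMeasure X}
    (hμ : (μ : Measure X) = m + a) (hν : (ν : Measure X) = m + b) :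
    wasserstein1 μ ν ≤ ∫⁻ x, ‖x‖ₑ ∂a + ∫⁻ x, ‖x‖ₑ ∂b := by
  by_cases h0 : a univ = 0
  · have ha : a = 0 := Measure.measure_univ_eq_zero.1 h0
    have hb : b = 0 := Measure.measure_univ_eq_zero.1 (hab ▸ h0)
    have : μ = ν := Subtype.ext (hμ.trans (by rw [ha, ← hb, ← hν]; rfl))
    rw [this, wasserstein1_self]
    exact zero_le
  have hr : a univ ≠ ∞ := measure_ne_top a univ
  have hm : IsFiniteMeasure m := by
    refine ⟨lt_of_le_of_lt ?_ (measure_lt_top (μ : Measure X) univ)⟩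
    rw [hμ]; simp
  -- the common part stays in place, the remainders are coupled independently
  let P : Measure (X × X) := m.map (fun x => (x, x)) + (a univ)⁻¹ • a.prod b
  have hdiag : Measurable fun x : X => (x, x) := by fun_prop
  have h1 : P.map Prod.fst = (μ : Measure X) := by
    rw [hμ, Measure.map_add _ _ measurable_fst, Measure.map_map measurable_fst hdiag,
      Measure.map_smul, Measure.map_fst_prod, smul_smul, ← hab, ENNReal.inv_mul_cancel h0 hr,
      one_smul]
    exact congrArg (· + a) Measure.map_id
  have h2 : P.map Prod.snd = (ν : Measure X) := by
    rw [hν, Measure.map_add _ _ measurable_snd, Measure.map_map measurable_snd hdiag,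
      Measure.map_smul, Measure.map_snd_prod, smul_smul, ENNReal.inv_mul_cancel h0 hr,
      one_smul]
    exact congrArg (· + b) Measure.map_id
  have hP : IsProbabilityMeasure P := by
    have : IsProbabilityMeasure (P.map Prod.fst) := h1 ▸ inferInstance
    exact Measure.isProbabilityMeasure_of_map Prod.fst
  refine (wasserstein1_le_lintegral P measurable_fst measurable_snd h1 h2).trans ?_
  rw [lintegral_add_measure, lintegral_map (by fun_prop) hdiag, lintegral_smul_measure]
  simp only [sub_self, enorm_zero, lintegral_const, zero_mul, zero_add]
  calc (a univ)⁻¹ • ∫⁻ p, ‖p.1 - p.2‖ₑ ∂(a.prod b)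
      ≤ (a univ)⁻¹ • ∫⁻ p, (‖p.1‖ₑ + ‖p.2‖ₑ) ∂(a.prod b) := by
        refine smul_le_smul_of_nonneg_left (lintegral_mono fun p => ?_) zero_le
        rw [sub_eq_add_neg, ← enorm_neg p.2]
        exact enorm_add_le _ _
    _ = _ := by
        rw [lintegral_add_left (by fun_prop), lintegral_prod _ (by fun_prop),
          lintegral_prod _ (by fun_prop)]
        simp only [lintegral_const, smul_eq_mul, mul_add]
        rw [lintegral_mul_const _ (by fun_prop), ← hab, mul_comm (∫⁻ x, ‖x‖ₑ ∂a),
          mul_comm (∫⁻ x, ‖x‖ₑ ∂b), ← mul_assoc, ← mul_assoc, ENNReal.inv_mul_cancel h0 hr,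
          one_mul, one_mul]

variable [CompleteSpace X]

/-- The triangle inequality for `W₁`: two transport plans with a common marginal are glued along
it, by disintegrating the second one. -/
theorem wasserstein1_triangle (μ ν ρ : ProbabilityMeasure X) :
    wasserstein1 μ ρ ≤ wasserstein1 μ ν + wasserstein1 ν ρ := by
  have : Nonempty X := ⟨0⟩
  rw [wasserstein1, wasserstein1, wasserstein1]
  simp_rw [ENNReal.iInf_add, ENNReal.add_iInf]
  refine le_iInf₂ fun π₁ h₁ => le_iInf₂ fun π₂ h₂ => ?_
  let κ := (π₂ : Measure (X × X)).condKernel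
  let P := (π₁ : Measure (X × X)).compProd (κ.comap Prod.snd measurable_snd)
  have hP : P.map (fun p => (p.1.2, p.2)) = (π₂ : Measure (X × X)) := by
    rw [map_compProd_comap, h₁.2, ← h₂.1]
    exact (π₂ : Measure (X × X)).disintegrate κ
  have hP₁ : P.map Prod.fst = (π₁ : Measure (X × X)) := Measure.fst_compProd _ _
  have hf : P.map (fun p => p.1.1) = (μ : Measure X) := by
    rw [← h₁.1, ← hP₁, Measure.map_map measurable_fst measurable_fst]; rfl
  have hg : P.map (fun p => p.2) = (ρ : Measure X) := by
    rw [← h₂.2, ← hP, Measure.map_map measurable_snd (by fun_prop)]; rfl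
  refine (wasserstein1_le_lintegral P (by fun_prop) (by fun_prop) hf hg).trans ?_
  calc ∫⁻ p, ‖p.1.1 - p.2‖ₑ ∂P
      ≤ ∫⁻ p, (‖p.1.1 - p.1.2‖ₑ + ‖p.1.2 - p.2‖ₑ) ∂P := by
        refine lintegral_mono fun p => ?_
        rw [← sub_add_sub_cancel p.1.1 p.1.2 p.2]
        exact enorm_add_le _ _
    _ = ∫⁻ p, ‖p.1.1 - p.1.2‖ₑ ∂P + ∫⁻ p, ‖p.1.2 - p.2‖ₑ ∂P :=
        lintegral_add_left (by fun_prop) _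
    _ = _ := by
        congr 1
        · rw [← hP₁, lintegral_map (by fun_prop) measurable_fst]
        · rw [← hP, lintegral_map (by fun_prop) (by fun_prop)]

/-- Completeness of `W₁`: along a sequence of optimal-up-to-`2⁻ⁿ` transport plans, realised on one
probability space as the successive transitions of a Markov chain, the positions converge almost
surely, and the law of the limit is the limit of the laws. -/
theorem exists_tendsto_wasserstein1 (μ : ℕ → ProbabilityMeasure X)
    (h : ∑' n, wasserstein1 (μ n) (μ (n + 1)) ≠ ∞) :
    ∃ ν : ProbabilityMeasure X, Tendsto (fun n => wasserstein1 (μ n) ν) atTop (𝓝 0) ∧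
      ∀ G : X →ᵇ ℝ, Tendsto (fun n => ∫ u, G u ∂(μ n : Measure X)) atTop
        (𝓝 (∫ u, G u ∂(ν : Measure X))) := by
  have : Nonempty X := ⟨0⟩
  have hplan : ∀ n, ∃ π : ProbabilityMeasure (X × X), IsTransferPlan π (μ n) (μ (n + 1)) ∧
      ∫⁻ p, ‖p.1 - p.2‖ₑ ∂(π : Measure (X × X)) <
        wasserstein1 (μ n) (μ (n + 1)) + 2⁻¹ ^ n := by
    intro n
    have hlt : wasserstein1 (μ n) (μ (n + 1)) < wasserstein1 (μ n) (μ (n + 1)) + 2⁻¹ ^ n :=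
      ENNReal.lt_add_right (ENNReal.ne_top_of_tsum_ne_top h n) (by simp)
    obtain ⟨π, hπ⟩ := iInf_lt_iff.1 hlt
    obtain ⟨h₁, h₂⟩ := iInf_lt_iff.1 hπ
    exact ⟨π, h₁, h₂⟩
  choose π hπ hcost using hplan
  let κ : (n : ℕ) → ProbabilityTheory.Kernel ((i : Finset.Iic n) → X) X := fun n =>
    (π n : Measure (X × X)).condKernel.comap (fun x => x ⟨n, by simp⟩) (by fun_prop)
  have hκ : ∀ n, ProbabilityTheory.IsMarkovKernel (κ n) := fun n => by
    dsimp only [κ]; infer_instance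
  let P : Measure (ℕ → X) :=
    ProbabilityTheory.Kernel.trajMeasure (X := fun _ => X) (μ 0 : Measure X) κ
  have hP : IsProbabilityMeasure P := by dsimp only [P]; infer_instance
  have hstep : ∀ n, P.map (fun x => x n) = (μ n : Measure X) →
      P.map (fun x => (x n, x (n + 1))) = (π n : Measure (X × X)) := by
    intro n hn
    have e := ProbabilityTheory.Kernel.map_frestrictLe_trajMeasure_compProd_eq_map_trajMeasure
      (X := fun _ => X) (κ := κ) (μ₀ := (μ 0 : Measure X)) (a := n)
    have hQ : IsProbabilityMeasure (P.map (Preorder.frestrictLe (π := fun _ => X) n)) :=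
      Measure.isProbabilityMeasure_map (by fun_prop)
    have e₁ := map_compProd_comap (P.map (Preorder.frestrictLe (π := fun _ => X) n))
      (g := fun x => x ⟨n, by simp⟩) (by fun_prop) (π n : Measure (X × X)).condKernel
    have e₂ := congrArg (Measure.map fun p => (p.1 ⟨n, by simp⟩, p.2)) e
    rw [Measure.map_map (by fun_prop) (by fun_prop)] at e₁ e₂
    refine e₂.symm.trans (e₁.trans ?_)
    have : P.map (fun x => x n) = (π n : Measure (X × X)).fst := hn.trans (hπ n).1.symm
    exact (congrArg (fun Q => Measure.compProd Q (π n : Measure (X × X)).condKernel) this).trans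
      ((π n : Measure (X × X)).disintegrate _)
  have hlaw : ∀ n, P.map (fun x => x n) = (μ n : Measure X) := by
    intro n
    induction n with
    | zero =>
      have e : (P.map (Preorder.frestrictLe (π := fun _ => X) 0)).map (fun x => x ⟨0, by simp⟩) =
          (μ 0 : Measure X) := by
        dsimp only [P]
        rw [ProbabilityTheory.Kernel.trajMeasure, Measure.map_comp _ _ (by fun_prop),
          ProbabilityTheory.Kernel.traj_map_frestrictLe,
          ProbabilityTheory.Kernel.partialTraj_self, Measure.id_comp,
          Measure.map_map (by fun_prop) (by fun_prop)]
        exact Measure.map_id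
      rw [Measure.map_map (by fun_prop) (by fun_prop)] at e
      exact e
    | succ n ih =>
      rw [← (hπ n).2, ← hstep n ih, Measure.map_map measurable_snd (by fun_prop)]
      rfl
  have hdist : ∀ n, ∫⁻ x, ‖x n - x (n + 1)‖ₑ ∂P ≤
      wasserstein1 (μ n) (μ (n + 1)) + 2⁻¹ ^ n := by
    intro n
    refine le_trans (le_of_eq ?_) (hcost n).le
    rw [← hstep n (hlaw n), lintegral_map (by fun_prop) (by fun_prop)]
  have hsum : ∑' n, ∫⁻ x, ‖x n - x (n + 1)‖ₑ ∂P ≠ ∞ := by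
    refine ne_top_of_le_ne_top ?_ (ENNReal.tsum_le_tsum hdist)
    rw [ENNReal.tsum_add, ENNReal.tsum_geometric]
    exact ENNReal.add_ne_top.2 ⟨h, by simp⟩
  have hae : ∀ᵐ x ∂P, ∑' n, ‖x n - x (n + 1)‖ₑ < ∞ := by
    refine ae_lt_top (by fun_prop) ?_
    rwa [lintegral_tsum fun n => by fun_prop]
  have hlim : ∀ᵐ x ∂P, ∃ l : X, Tendsto (fun n => x n) atTop (𝓝 l) := by
    filter_upwards [hae] with x hx
    refine cauchySeq_tendsto_of_complete
      (cauchySeq_of_edist_le_of_tsum_ne_top (fun n => ‖x n - x (n + 1)‖ₑ) (fun n => ?_) hx.ne)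
    exact (edist_eq_enorm_sub _ _).le
  obtain ⟨Y, hY, hYlim⟩ := measurable_limit_of_tendsto_metrizable_ae
    (fun n => (measurable_pi_apply n).aemeasurable) hlim
  let ν : ProbabilityMeasure X := ⟨P.map Y, Measure.isProbabilityMeasure_map hY.aemeasurable⟩
  refine ⟨ν, ?_, fun G => ?_⟩
  · have hle : ∀ n, wasserstein1 (μ n) ν ≤ ∑' k, ∫⁻ x, ‖x (k + n) - x (k + n + 1)‖ₑ ∂P := by
      intro n
      refine (wasserstein1_le_lintegral P (measurable_pi_apply n) hY (hlaw n) rfl).trans ?_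
      rw [← lintegral_tsum fun n => by fun_prop]
      refine lintegral_mono_ae ?_
      filter_upwards [hYlim] with x hx
      rw [← edist_eq_enorm_sub]
      have := edist_le_tsum_of_edist_le_of_tendsto (fun n => ‖x n - x (n + 1)‖ₑ)
        (fun n => (edist_eq_enorm_sub _ _).le) hx n
      simpa only [add_comm n] using this
    exact tendsto_of_tendsto_of_tendsto_of_le_of_le tendsto_const_nhds
      (ENNReal.tendsto_sum_nat_add _ hsum) (fun _ => zero_le) hle
  · have e : ∀ n, ∫ u, G u ∂(μ n : Measure X) = ∫ x, G (x n) ∂P := fun n => by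
      rw [← hlaw n, integral_map (measurable_pi_apply n).aemeasurable
        G.continuous.aestronglyMeasurable]
    have e' : ∫ u, G u ∂(ν : Measure X) = ∫ x, G (Y x) ∂P :=
      integral_map hY.aemeasurable G.continuous.aestronglyMeasurable
    simp_rw [e, e']
    refine tendsto_integral_of_dominated_convergence (fun _ => ‖G‖) (fun n => ?_)
      (integrable_const _) (fun n => ae_of_all _ fun x => G.norm_coe_le_norm _) ?_
    · exact (G.continuous.measurable.comp (measurable_pi_apply n)).aestronglyMeasurable
    · filter_upwards [hYlim] with x hx
      exact (G.continuous.tendsto _).comp hx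

end Wasserstein

/-! ### Finitely supported laws -/

section WassersteinSpace

/-- The probability measures on `X` as a space with the (extended) distance `W₁`, as opposed to the
topology of weak convergence that `ProbabilityMeasure X` carries. -/
def WassersteinSpace (X : Type*) [MeasurableSpace X] : Type _ := ProbabilityMeasure X

variable {X : Type*} [NormedAddCommGroup X] [MeasurableSpace X] [BorelSpace X]
  [SecondCountableTopology X] [CompleteSpace X]

noncomputable instance : PseudoEMetricSpace (WassersteinSpace X) where
  edist := fun μ ν => wasserstein1 (X := X) μ ν
  edist_self := wasserstein1_self (X := X)
  edist_comm := wasserstein1_comm (X := X)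
  edist_triangle := wasserstein1_triangle (X := X)

/-- A probability measure as a point of the Wasserstein space. -/
def toWasserstein (μ : ProbabilityMeasure X) : WassersteinSpace X := μ

theorem edist_toWasserstein (μ ν : ProbabilityMeasure X) :
    edist (toWasserstein μ) (toWasserstein ν) = wasserstein1 μ ν := rfl

/-- The law of `f` under `μ`, as a point of the Wasserstein space. -/
noncomputable def pushLaw (μ : ProbabilityMeasure X) {f : X → X} (hf : Measurable f) :
    WassersteinSpace X :=
  toWasserstein (μ.map hf.aemeasurable)

theorem edist_pushLaw_le (μ : ProbabilityMeasure X) {f g : X → X} (hf : Measurable f)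
    (hg : Measurable g) :
    edist (pushLaw μ hf) (pushLaw μ hg) ≤ ∫⁻ u, ‖f u - g u‖ₑ ∂(μ : Measure X) :=
  wasserstein1_le_lintegral (μ : Measure X) hf hg rfl rfl

theorem edist_self_pushLaw_le (μ : ProbabilityMeasure X) {f : X → X} (hf : Measurable f) :
    edist (toWasserstein μ) (pushLaw μ hf) ≤ ∫⁻ u, ‖u - f u‖ₑ ∂(μ : Measure X) :=
  wasserstein1_le_lintegral (ν := μ.map hf.aemeasurable) (μ : Measure X) measurable_id hf
    Measure.map_id rfl

/-- The law `∑ wᵢ δ_{eᵢ}` with atoms `eᵢ` and weights `wᵢ`. -/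
noncomputable def discreteLaw {ι : Type*} [Fintype ι] (e : ι → X) (w : stdSimplex ℝ ι) :
    WassersteinSpace X :=
  toWasserstein ⟨∑ i, ENNReal.ofReal (w.1 i) • Measure.dirac (e i), ⟨by
    simp only [Measure.coe_finsetSum, Finset.sum_apply, Measure.smul_apply, measure_univ,
      smul_eq_mul, mul_one]
    rw [← ENNReal.ofReal_sum_of_nonneg fun i _ => w.2.1 i, w.2.2, ENNReal.ofReal_one]⟩⟩

/-- Only the differences of the weights have to be moved; the atoms keep the smaller weight. -/
theorem edist_discreteLaw_le {ι : Type*} [Fintype ι] (e : ι → X) (w w' : stdSimplex ℝ ι) :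
    edist (discreteLaw e w) (discreteLaw e w') ≤ ∑ i, ENNReal.ofReal |w.1 i - w'.1 i| * ‖e i‖ₑ := by
  let m : Measure X := ∑ i, ENNReal.ofReal (min (w.1 i) (w'.1 i)) • Measure.dirac (e i)
  let r : (ι → ℝ) → Measure X := fun v =>
    ∑ i, ENNReal.ofReal (v i - min (w.1 i) (w'.1 i)) • Measure.dirac (e i)
  have hr : ∀ v, IsFiniteMeasure (r v) := fun v => ⟨by simp [r]⟩
  have hadd : ∀ v : ι → ℝ, (∀ i, min (w.1 i) (w'.1 i) ≤ v i) →
      ∑ i, ENNReal.ofReal (v i) • Measure.dirac (e i) = m + r v := by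
    intro v hv
    rw [← Finset.sum_add_distrib]
    refine Finset.sum_congr rfl fun i _ => ?_
    rw [← add_smul, ← ENNReal.ofReal_add (le_min (w.2.1 i) (w'.2.1 i)) (sub_nonneg.2 (hv i)),
      add_sub_cancel]
  have hmass : ∀ v : stdSimplex ℝ ι, (∀ i, min (w.1 i) (w'.1 i) ≤ v.1 i) →
      r v.1 univ = ENNReal.ofReal (1 - ∑ i, min (w.1 i) (w'.1 i)) := by
    intro v hv
    simp only [r, Measure.coe_finsetSum, Finset.sum_apply, Measure.smul_apply, measure_univ,
      smul_eq_mul, mul_one]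
    rw [← ENNReal.ofReal_sum_of_nonneg fun i _ => sub_nonneg.2 (hv i), Finset.sum_sub_distrib,
      v.2.2]
  have hw : ∀ i, min (w.1 i) (w'.1 i) ≤ w.1 i := fun i => min_le_left _ _
  have hw' : ∀ i, min (w.1 i) (w'.1 i) ≤ w'.1 i := fun i => min_le_right _ _
  refine (wasserstein1_le_of_common_part (μ := ⟨_, (discreteLaw e w).2⟩)
    (ν := ⟨_, (discreteLaw e w').2⟩) (m := m) (a := r w.1) (b := r w'.1)
    ((hmass w hw).trans (hmass w' hw').symm) (hadd w.1 hw) (hadd w'.1 hw')).trans_eq ?_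
  simp only [r, lintegral_finsetSum_measure, lintegral_smul_measure, lintegral_dirac, smul_eq_mul]
  rw [← Finset.sum_add_distrib]
  refine Finset.sum_congr rfl fun i _ => ?_
  rw [← add_mul, ← ENNReal.ofReal_add (sub_nonneg.2 (hw i)) (sub_nonneg.2 (hw' i))]
  congr 2
  rcases le_total (w.1 i) (w'.1 i) with h | h
  · rw [min_eq_left h, abs_sub_comm, abs_of_nonneg (sub_nonneg.2 h)]; ring
  · rw [min_eq_right h, abs_of_nonneg (sub_nonneg.2 h)]; ring

theorem continuous_discreteLaw {ι : Type*} [Fintype ι] (e : ι → X) :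
    Continuous (discreteLaw e) := by
  refine continuous_iff_continuousAt.2 fun w => ?_
  rw [ContinuousAt, tendsto_iff_edist_tendsto_0]
  have h : Tendsto (fun w' : stdSimplex ℝ ι =>
      ∑ i, ENNReal.ofReal |w'.1 i - w.1 i| * ‖e i‖ₑ) (𝓝 w) (𝓝 0) := by
    rw [← Finset.sum_const_zero (ι := ι) (s := Finset.univ)]
    refine tendsto_finsetSum _ fun i _ => ?_
    have hc : Continuous fun w' : stdSimplex ℝ ι => ENNReal.ofReal |w'.1 i - w.1 i| :=
      ENNReal.continuous_ofReal.comp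
        ((((continuous_apply i).comp continuous_subtype_val).sub continuous_const).abs)
    have := ENNReal.Tendsto.mul_const (b := ‖e i‖ₑ) (hc.tendsto w) (Or.inr (by simp))
    simpa using this
  exact tendsto_of_tendsto_of_tendsto_of_le_of_le tendsto_const_nhds h (fun _ => zero_le)
    fun w' => edist_discreteLaw_le e w' w

/-- The probabilities that a simple function takes its different values. -/
noncomputable def simpleWeights (D : SimpleFunc X X) (μ : ProbabilityMeasure X) :
    stdSimplex ℝ D.range :=
  ⟨fun i => (μ : Measure X).real (D ⁻¹' {i.1}), fun _ => measureReal_nonneg, by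
    have := sum_measureReal_preimage_singleton (μ := (μ : Measure X)) D.range
      (fun y _ => D.measurableSet_fiber y)
    rw [Finset.sum_coe_sort D.range fun y => (μ : Measure X).real (D ⁻¹' {y}), this]
    have h : D ⁻¹' (D.range : Set X) = univ := by
      ext x; simp
    rw [h, probReal_univ]⟩

/-- The law of a simple function has the values of the function as atoms. -/
theorem pushLaw_simpleFunc (D : SimpleFunc X X) (μ : ProbabilityMeasure X) :
    pushLaw μ D.measurable = discreteLaw (fun i : D.range => i.1) (simpleWeights D μ) := by
  refine Subtype.ext (Measure.ext_of_lintegral _ fun f hf => ?_)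
  change ∫⁻ x, f x ∂((μ : Measure X).map D) =
    ∫⁻ x, f x ∂(∑ i : D.range, ENNReal.ofReal ((μ : Measure X).real (D ⁻¹' {i.1})) •
      Measure.dirac i.1)
  rw [lintegral_map hf D.measurable]
  simp only [lintegral_finsetSum_measure, lintegral_smul_measure, lintegral_dirac, smul_eq_mul]
  have hreal : ∀ y, ENNReal.ofReal ((μ : Measure X).real (D ⁻¹' {y})) =
      (μ : Measure X) (D ⁻¹' {y}) := fun y => ofReal_measureReal
  simp_rw [hreal]
  rw [Finset.sum_coe_sort D.range fun y => (μ : Measure X) (D ⁻¹' {y}) * f y]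
  have := SimpleFunc.map_lintegral f D (μ := (μ : Measure X))
  rw [← SimpleFunc.lintegral_eq_lintegral] at this
  simpa [mul_comm] using this

end WassersteinSpace

/-! ### Measurability in time -/

section Measurability

variable {X : Type*} [NormedAddCommGroup X] [MeasurableSpace X] [BorelSpace X]
  {Ω : Type*} [MeasurableSpace Ω] {m : Measure Ω} {μ ν : Ω → ProbabilityMeasure X}

/-- For a weak-`*` measurable map `t ↦ μ_t`, the measure of every Borel set is a measurable function
of `t`: closed sets are limits of bounded continuous functions, and they generate. -/
theorem aemeasurable_measure_apply
    (hμ : ∀ F : X →ᵇ ℝ, AEMeasurable (fun t => ∫ u, F u ∂(μ t : Measure X)) m)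
    {A : Set X} (hA : MeasurableSet A) : AEMeasurable (fun t => (μ t : Measure X) A) m := by
  induction A, hA using MeasurableSpace.induction_on_inter
    (borel_eq_generateFrom_isClosed (α := X) ▸ BorelSpace.measurable_eq) isPiSystem_isClosed with
  | empty => simp
  | basic A hA =>
    refine aemeasurable_of_tendsto_metrizable_ae atTop (f := fun (n : ℕ) t =>
      ∫⁻ u, thickenedIndicator (δ := 1 / ((n : ℝ) + 1)) (by positivity) A u ∂(μ t : Measure X))
      (fun n => ?_) (ae_of_all _ fun t =>
        tendsto_lintegral_thickenedIndicator_of_isClosed _ hA (fun n => by positivity)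
          tendsto_one_div_add_atTop_nhds_zero_nat)
    let F : X →ᵇ ℝ≥0 := thickenedIndicator (δ := 1 / ((n : ℝ) + 1)) (by positivity) A
    let G : X →ᵇ ℝ := BoundedContinuousFunction.ofNormedAddCommGroup (fun u => (F u : ℝ))
      (by fun_prop) 1 fun u => by
        rw [Real.norm_eq_abs, NNReal.abs_eq]
        exact NNReal.coe_le_one.2 (thickenedIndicator_le_one _ A u)
    refine (hμ G).ennreal_ofReal.congr (ae_of_all _ fun t => ?_)
    change ENNReal.ofReal (∫ u, (F u : ℝ) ∂(μ t : Measure X)) = ∫⁻ u, F u ∂(μ t : Measure X)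
    rw [ofReal_integral_eq_lintegral_ofReal]
    · simp
    · exact G.integrable _
    · exact ae_of_all _ fun u => NNReal.coe_nonneg _
  | compl A hA ih =>
    simp_rw [prob_compl_eq_one_sub hA]
    exact aemeasurable_const.sub ih
  | iUnion f hd hf ih =>
    simp_rw [measure_iUnion hd hf]
    exact AEMeasurable.tsum ih

theorem aemeasurable_lintegral
    (hμ : ∀ F : X →ᵇ ℝ, AEMeasurable (fun t => ∫ u, F u ∂(μ t : Measure X)) m)
    {g : X → ℝ≥0∞} (hg : Measurable g) :
    AEMeasurable (fun t => ∫⁻ u, g u ∂(μ t : Measure X)) m := by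
  refine Measurable.ennreal_induction (motive := fun g =>
    AEMeasurable (fun t => ∫⁻ u, g u ∂(μ t : Measure X)) m) ?_ ?_ ?_ hg
  · intro c A hA
    simp_rw [lintegral_indicator_const hA]
    exact (aemeasurable_measure_apply hμ hA).const_mul c
  · intro f g _ hf _ ihf ihg
    simp_rw [Pi.add_apply, lintegral_add_left hf]
    exact ihf.add ihg
  · intro f hf hmono ih
    have : ∀ t, ∫⁻ u, ⨆ n, f n u ∂(μ t : Measure X) = ⨆ n, ∫⁻ u, f n u ∂(μ t : Measure X) :=
      fun t => lintegral_iSup hf hmono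
    simp_rw [this]
    exact AEMeasurable.iSup ih

theorem aemeasurable_simpleWeights
    (hμ : ∀ F : X →ᵇ ℝ, AEMeasurable (fun t => ∫ u, F u ∂(μ t : Measure X)) m)
    (D : SimpleFunc X X) : AEMeasurable (fun t => simpleWeights D (μ t)) m := by
  have h : AEMeasurable (fun t => fun i : D.range => (μ t : Measure X).real (D ⁻¹' {i.1})) m :=
    aemeasurable_pi_lambda _ fun i =>
      (aemeasurable_measure_apply hμ (D.measurableSet_fiber _)).ennreal_toReal
  exact h.subtype_mk

variable [SecondCountableTopology X] [CompleteSpace X]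

/-- Discretisation approximates every law with a first moment in `W₁`; the first moment provides the
dominating function. -/
theorem tendsto_pushLaw_approxOn (ρ : ProbabilityMeasure X)
    (hρ : ∫⁻ u, ‖u‖ₑ ∂(ρ : Measure X) < ∞) :
    Tendsto (fun n => pushLaw ρ (SimpleFunc.approxOn id measurable_id univ (0 : X) (mem_univ _)
      n).measurable) atTop (𝓝 (toWasserstein ρ)) := by
  rw [tendsto_iff_edist_tendsto_0]
  have h : Tendsto (fun n => ∫⁻ u, ‖u - SimpleFunc.approxOn id measurable_id univ (0 : X)
      (mem_univ _) n u‖ₑ ∂(ρ : Measure X)) atTop (𝓝 0) := by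
    rw [← lintegral_zero (μ := (ρ : Measure X))]
    refine tendsto_lintegral_of_dominated_convergence (fun u => ‖u‖ₑ) (fun n => ?_) (fun n => ?_)
      hρ.ne (ae_of_all _ fun u => ?_)
    · exact (measurable_id.sub (SimpleFunc.measurable _)).enorm
    · refine ae_of_all _ fun u => ?_
      have := SimpleFunc.edist_approxOn_le (f := id) measurable_id (s := univ) (y₀ := (0 : X))
        (mem_univ _) u n
      rw [edist_comm, edist_comm (0 : X)] at this
      simpa [edist_eq_enorm_sub] using this
    · have := SimpleFunc.tendsto_approxOn (f := id) measurable_id (s := univ) (y₀ := (0 : X))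
        (mem_univ _) (x := u) (by simp)
      rw [tendsto_iff_edist_tendsto_0] at this
      refine this.congr fun n => ?_
      rw [edist_comm, edist_eq_enorm_sub]; rfl
  refine tendsto_of_tendsto_of_tendsto_of_le_of_le tendsto_const_nhds h (fun _ => zero_le)
    fun n => ?_
  rw [edist_comm]
  exact edist_self_pushLaw_le _ _

theorem measurable_edist_discreteLaw {ι : Type*} [Fintype ι] (e : ι → X) :
    Measurable fun p : stdSimplex ℝ ι × stdSimplex ℝ ι =>
      edist (discreteLaw e p.1) (discreteLaw e p.2) := by
  have hc : Continuous fun p : stdSimplex ℝ ι × stdSimplex ℝ ι =>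
      edist (discreteLaw e p.1) (discreteLaw e p.2) :=
    ((continuous_discreteLaw e).comp continuous_fst).edist
      ((continuous_discreteLaw e).comp continuous_snd)
  exact hc.measurable

theorem aemeasurable_edist_pushLaw
    (hμ : ∀ F : X →ᵇ ℝ, AEMeasurable (fun t => ∫ u, F u ∂(μ t : Measure X)) m)
    (hν : ∀ F : X →ᵇ ℝ, AEMeasurable (fun t => ∫ u, F u ∂(ν t : Measure X)) m)
    (D : SimpleFunc X X) :
    AEMeasurable (fun t => edist (pushLaw (μ t) D.measurable) (pushLaw (ν t) D.measurable)) m := by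
  have h := (measurable_edist_discreteLaw (fun i : D.range => i.1)).comp_aemeasurable
    ((aemeasurable_simpleWeights hμ D).prodMk (aemeasurable_simpleWeights hν D))
  refine h.congr (ae_of_all _ fun t => ?_)
  exact congrArg₂ edist (pushLaw_simpleFunc D (μ t)).symm (pushLaw_simpleFunc D (ν t)).symm

/-- `t ↦ W₁(μ_t, ν_t)` is measurable: it is the limit of the distances of discretised laws, which
are continuous functions of finitely many measurable weights. -/
theorem aemeasurable_wasserstein1
    (hμ : ∀ F : X →ᵇ ℝ, AEMeasurable (fun t => ∫ u, F u ∂(μ t : Measure X)) m)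
    (hν : ∀ F : X →ᵇ ℝ, AEMeasurable (fun t => ∫ u, F u ∂(ν t : Measure X)) m)
    (hμ₁ : ∀ᵐ t ∂m, ∫⁻ u, ‖u‖ₑ ∂(μ t : Measure X) < ∞)
    (hν₁ : ∀ᵐ t ∂m, ∫⁻ u, ‖u‖ₑ ∂(ν t : Measure X) < ∞) :
    AEMeasurable (fun t => wasserstein1 (μ t) (ν t)) m := by
  let D : ℕ → SimpleFunc X X := SimpleFunc.approxOn id measurable_id univ (0 : X) (mem_univ _)
  refine aemeasurable_of_tendsto_metrizable_ae atTop (f := fun n t =>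
    edist (pushLaw (μ t) (D n).measurable) (pushLaw (ν t) (D n).measurable)) (fun n => ?_) ?_
  · exact aemeasurable_edist_pushLaw hμ hν (D n)
  · filter_upwards [hμ₁, hν₁] with t h₁ h₂
    exact (tendsto_pushLaw_approxOn _ h₁).edist (tendsto_pushLaw_approxOn _ h₂)

end Measurability

/-! ### The space `L¹_t(P)` as a complete pseudometric space -/

section TimeParametrized

instance secondCountableTopologyL2x (d : ℕ) : SecondCountableTopology (L2x d) :=
  haveI : Fact ((2 : ℝ≥0∞) ≠ ∞) := ⟨by simp⟩
  inferInstance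

/-- First moments stay finite in a limit for `W₁`. -/
theorem lintegral_enorm_le_add_wasserstein1 {X : Type*} [NormedAddCommGroup X] [MeasurableSpace X]
    [BorelSpace X] [SecondCountableTopology X] (μ ν : ProbabilityMeasure X) :
    ∫⁻ u, ‖u‖ₑ ∂(ν : Measure X) ≤ ∫⁻ u, ‖u‖ₑ ∂(μ : Measure X) + wasserstein1 μ ν := by
  rw [wasserstein1]
  simp_rw [ENNReal.add_iInf]
  refine le_iInf₂ fun π hπ => ?_
  rw [← hπ.1, ← hπ.2, lintegral_map (by fun_prop) measurable_fst,
    lintegral_map (by fun_prop) measurable_snd, ← lintegral_add_left (by fun_prop)]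
  refine lintegral_mono fun p => ?_
  have := enorm_sub_le (a := p.1) (b := p.1 - p.2)
  simpa using this

variable {d : ℕ} {T : ℝ}

theorem TimeParamMeasure.aemeasurable_lintegral (μ : TimeParamMeasure d T) {g : L2x d → ℝ≥0∞}
    (hg : Measurable g) :
    AEMeasurable (fun t => ∫⁻ u, g u ∂(μ.at_time t : Measure (L2x d))) (timeMeasure T) :=
  StatSol.aemeasurable_lintegral μ.weakStar_measurable hg

theorem TimeParamMeasure.ae_lintegral_enorm_lt_top (μ : TimeParamMeasure d T) :
    ∀ᵐ t ∂(timeMeasure T), ∫⁻ u, ‖u‖ₑ ∂(μ.at_time t : Measure (L2x d)) < ∞ :=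
  ae_lt_top' (μ.aemeasurable_lintegral measurable_enorm) μ.integrable.ne

theorem TimeParamMeasure.aemeasurable_wasserstein1 (μ ν : TimeParamMeasure d T) :
    AEMeasurable (fun t => wasserstein1 (μ.at_time t) (ν.at_time t)) (timeMeasure T) :=
  StatSol.aemeasurable_wasserstein1 μ.weakStar_measurable ν.weakStar_measurable
    μ.ae_lintegral_enorm_lt_top ν.ae_lintegral_enorm_lt_top

theorem distT_toL1P (μ ν : TimeParamMeasure d T) :
    distT μ.toL1P ν.toL1P =
      ∫⁻ t, wasserstein1 (μ.at_time t) (ν.at_time t) ∂(timeMeasure T) := rfl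

theorem exists_toL1P_eq (u : L1P d T) : ∃ μ : TimeParamMeasure d T, μ.toL1P = u :=
  Quotient.exists_rep u

theorem distT_self (u : L1P d T) : distT u u = 0 := by
  obtain ⟨μ, rfl⟩ := exists_toL1P_eq u
  simp [distT_toL1P, wasserstein1_self]

theorem distT_comm (u v : L1P d T) : distT u v = distT v u := by
  obtain ⟨μ, rfl⟩ := exists_toL1P_eq u
  obtain ⟨ν, rfl⟩ := exists_toL1P_eq v
  simp_rw [distT_toL1P]
  exact lintegral_congr fun t => wasserstein1_comm _ _

theorem distT_triangle (u v w : L1P d T) : distT u w ≤ distT u v + distT v w := by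
  obtain ⟨μ, rfl⟩ := exists_toL1P_eq u
  obtain ⟨ν, rfl⟩ := exists_toL1P_eq v
  obtain ⟨ρ, rfl⟩ := exists_toL1P_eq w
  simp_rw [distT_toL1P]
  -- the lower Lebesgue integral is additive only because the first summand is measurable in time
  rw [← lintegral_add_left' (μ.aemeasurable_wasserstein1 ν)]
  exact lintegral_mono fun t => wasserstein1_triangle _ _ _

/-- The extended pseudometric `d_T`, with its own uniformity and topology. -/
@[reducible]
noncomputable def pseudoEMetricDistT (d : ℕ) (T : ℝ) : PseudoEMetricSpace (L1P d T) where
  edist := distT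
  edist_self := distT_self
  edist_comm := distT_comm
  edist_triangle := distT_triangle

theorem topologicalSpaceL1P_eq (d : ℕ) (T : ℝ) :
    topologicalSpaceL1P d T =
      (pseudoEMetricDistT d T).toUniformSpace.toTopologicalSpace := by
  ext U
  rw [@EMetric.isOpen_iff _ (pseudoEMetricDistT d T) U]
  refine forall₂_congr fun μ _ => exists_congr fun ε => and_congr Iff.rfl ?_
  refine forall_congr' fun ν => ?_
  rw [distT_comm]
  rfl

/-- `d_T` as the extended pseudometric of the topological space `L¹_t(P)`. -/
noncomputable instance (d : ℕ) (T : ℝ) : PseudoEMetricSpace (L1P d T) :=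
  (pseudoEMetricDistT d T).replaceUniformity
    (U := (pseudoEMetricDistT d T).toUniformSpace.replaceTopology (topologicalSpaceL1P_eq d T)) rfl

theorem edist_toL1P (μ ν : TimeParamMeasure d T) :
    edist μ.toL1P ν.toL1P =
      ∫⁻ t, wasserstein1 (μ.at_time t) (ν.at_time t) ∂(timeMeasure T) := rfl

/-- Completeness of `L¹_t(P)`: a rapidly Cauchy sequence has `∑ W₁(μⁿ_t, μⁿ⁺¹_t) < ∞` for almost
every `t`, hence converges in `W₁` for almost every `t`. -/
instance (d : ℕ) (T : ℝ) : CompleteSpace (L1P d T) := by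
  refine EMetric.complete_of_convergent_controlled_sequences (fun n => 2⁻¹ ^ n)
    (fun n => ENNReal.pow_pos (by simp) n) fun u hu => ?_
  choose μ hμ using fun n => exists_toL1P_eq (u n)
  have hsum : ∑' n, edist (u n) (u (n + 1)) ≠ ∞ := by
    refine ne_top_of_le_ne_top ?_ (ENNReal.tsum_le_tsum fun n =>
      (hu n n (n + 1) le_rfl (Nat.le_succ n)).le)
    rw [ENNReal.tsum_geometric]; simp
  have hdist : ∀ n m, edist (u n) (u m) =
      ∫⁻ t, wasserstein1 ((μ n).at_time t) ((μ m).at_time t) ∂(timeMeasure T) := fun n m => by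
    rw [← hμ n, ← hμ m, edist_toL1P]
  have hint : ∀ n, ∫⁻ t, ∑' k, wasserstein1 ((μ (k + n)).at_time t) ((μ (k + n + 1)).at_time t)
      ∂(timeMeasure T) = ∑' k, edist (u (k + n)) (u (k + n + 1)) := fun n => by
    rw [lintegral_tsum fun k => (μ (k + n)).aemeasurable_wasserstein1 (μ (k + n + 1))]
    simp_rw [hdist]
  have hae : ∀ᵐ t ∂(timeMeasure T),
      ∑' k, wasserstein1 ((μ k).at_time t) ((μ (k + 1)).at_time t) ≠ ∞ := by
    have := ae_lt_top' (AEMeasurable.tsum fun k =>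
      (μ k).aemeasurable_wasserstein1 (μ (k + 1))) (by simpa using (hint 0).trans_ne hsum)
    filter_upwards [this] with t ht
    simpa using ht.ne
  have hex : ∀ t, ∃ ν : ProbabilityMeasure (L2x d),
      ∑' k, wasserstein1 ((μ k).at_time t) ((μ (k + 1)).at_time t) ≠ ∞ →
      Tendsto (fun n => wasserstein1 ((μ n).at_time t) ν) atTop (𝓝 0) ∧
      ∀ G : L2x d →ᵇ ℝ, Tendsto (fun n => ∫ u, G u ∂((μ n).at_time t : Measure (L2x d))) atTop
        (𝓝 (∫ u, G u ∂(ν : Measure (L2x d)))) := by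
    intro t
    by_cases h : ∑' k, wasserstein1 ((μ k).at_time t) ((μ (k + 1)).at_time t) ≠ ∞
    · obtain ⟨ν, hν⟩ := exists_tendsto_wasserstein1 (fun k => (μ k).at_time t) h
      exact ⟨ν, fun _ => hν⟩
    · exact ⟨(μ 0).at_time t, fun h' => absurd h' h⟩
  choose ν hν using hex
  have hle : ∀ n, ∀ᵐ t ∂(timeMeasure T), wasserstein1 ((μ n).at_time t) (ν t) ≤
      ∑' k, wasserstein1 ((μ (k + n)).at_time t) ((μ (k + n + 1)).at_time t) := by
    intro n
    filter_upwards [hae] with t ht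
    have hlim : Tendsto (fun k => toWasserstein ((μ k).at_time t)) atTop
        (𝓝 (toWasserstein (ν t))) := tendsto_iff_edist_tendsto_0.2 (hν t ht).1
    have := edist_le_tsum_of_edist_le_of_tendsto
      (fun k => wasserstein1 ((μ k).at_time t) ((μ (k + 1)).at_time t)) (fun k => le_rfl) hlim n
    simp only [add_comm n] at this
    exact this
  let ρ : TimeParamMeasure d T :=
    { at_time := ν
      weakStar_measurable := fun G =>
        aemeasurable_of_tendsto_metrizable_ae atTop (fun n => (μ n).weakStar_measurable G) (by
          filter_upwards [hae] with t ht using (hν t ht).2 G)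
      integrable := by
        refine lt_of_le_of_lt (lintegral_mono_ae (g := fun t =>
          ∫⁻ u, ‖u‖ₑ ∂((μ 0).at_time t : Measure (L2x d)) +
          ∑' k, wasserstein1 ((μ (k + 0)).at_time t) ((μ (k + 0 + 1)).at_time t)) ?_) ?_
        · filter_upwards [hle 0] with t ht
          exact (lintegral_enorm_le_add_wasserstein1 _ _).trans (add_le_add_right ht _)
        · rw [lintegral_add_left' ((μ 0).aemeasurable_lintegral measurable_enorm), hint 0]
          exact ENNReal.add_lt_top.2 ⟨(μ 0).integrable, hsum.lt_top⟩ }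
  refine ⟨ρ.toL1P, tendsto_iff_edist_tendsto_0.2 ?_⟩
  refine tendsto_of_tendsto_of_tendsto_of_le_of_le tendsto_const_nhds
    (ENNReal.tendsto_sum_nat_add _ hsum) (fun _ => zero_le) fun n => ?_
  rw [← hint n, ← hμ n, edist_toL1P]
  exact lintegral_mono_ae (hle n)

end TimeParametrized

/-! ### Increments of functions on the torus -/

section Increments

variable {d : ℕ}

/-- `∫_D |u(x + y) - u(x)|² dx`, for a single displacement `y`. -/
noncomputable def squareIncrement (u : L2x d) (y : Torus d) : ℝ≥0∞ :=
  ∫⁻ x : Torus d, ‖u (x + y) - u x‖ₑ ^ 2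

theorem continuous_toTorus : Continuous (toTorus : Phase d → Torus d) :=
  continuous_pi fun i => (AddCircle.continuous_mk' _).comp (by fun_prop)

theorem measurable_coe_L2x (u : L2x d) : Measurable (u : Torus d → Phase d) :=
  (Lp.stronglyMeasurable u).measurable

theorem measurable_squareIncrement (u : L2x d) : Measurable (squareIncrement u) := by
  have hu := measurable_coe_L2x u
  exact Measurable.lintegral_prod_right'
    (f := fun p : Torus d × Torus d => ‖u (p.2 + p.1) - u p.2‖ₑ ^ 2) (by fun_prop)

theorem meanSquareIncrement_eq (r : ℝ) (u : L2x d) :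
    meanSquareIncrement r u =
      ⨍⁻ h in Metric.ball (0 : Phase d) r, squareIncrement u (toTorus h) ∂volume := by
  have hu := measurable_coe_L2x u
  have ht := (continuous_toTorus (d := d)).measurable
  simp only [meanSquareIncrement, laverage_eq, squareIncrement, div_eq_mul_inv]
  rw [lintegral_mul_const _ (Measurable.lintegral_prod_right'
    (f := fun p : Torus d × Phase d => ‖u (p.1 + toTorus p.2) - u p.1‖ₑ ^ 2) (by fun_prop)),
    lintegral_lintegral_swap (by fun_prop)]

theorem enorm_sub_sq_le {E : Type*} [NormedAddCommGroup E] (a b c : E) :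
    ‖a - b‖ₑ ^ 2 ≤ 2 * (‖c - b‖ₑ ^ 2 + ‖c - a‖ₑ ^ 2) := by
  have h : ‖a - b‖ₑ ≤ ‖c - b‖ₑ + ‖c - a‖ₑ := by
    have := enorm_sub_le (a := c - b) (b := c - a)
    rwa [sub_sub_sub_cancel_left] at this
  have h2 := ENNReal.rpow_add_le_mul_rpow_add_rpow ‖c - b‖ₑ ‖c - a‖ₑ (one_le_two (α := ℝ))
  refine (pow_le_pow_left' h 2).trans ?_
  have e : (2 : ℝ) - 1 = 1 := by norm_num
  rw [e, ENNReal.rpow_one] at h2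
  exact_mod_cast h2

/-- The displacement `y` is the displacement `y + z` followed by the reverse of `z`; using `z` and
`y + z` avoids reflections. -/
theorem squareIncrement_le (u : L2x d) (y z : Torus d) :
    squareIncrement u y ≤ 2 * (squareIncrement u (y + z) + squareIncrement u z) := by
  have hu := measurable_coe_L2x u
  have hz : squareIncrement u z = ∫⁻ x : Torus d, ‖u (x + y + z) - u (x + y)‖ₑ ^ 2 :=
    (lintegral_add_right_eq_self (fun x : Torus d => ‖u (x + z) - u x‖ₑ ^ 2) y).symm
  rw [hz, squareIncrement, squareIncrement, ← lintegral_add_left (by fun_prop),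
    ← lintegral_const_mul _ (by fun_prop)]
  refine lintegral_mono fun x => ?_
  rw [← add_assoc]
  exact enorm_sub_sq_le _ _ _

/-- An averaged bound on the increments implies a bound on each of them: the displacement `k` is
reached from `h` and `k + h`, and `h` is averaged over a ball. -/
theorem squareIncrement_le_meanSquareIncrement {r : ℝ} (hr : 0 < r) (u : L2x d) {k : Phase d}
    (hk : ‖k‖ < r / 2) :
    squareIncrement u (toTorus k) ≤ 4 * 2 ^ d * meanSquareIncrement r u := by
  have hm : Measurable fun h : Phase d => squareIncrement u (toTorus h) :=
    (measurable_squareIncrement u).comp continuous_toTorus.measurable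
  set N : Phase d → ℝ≥0∞ := fun h => squareIncrement u (toTorus h) with hN
  set B := Metric.ball (0 : Phase d) r
  set B' := Metric.ball (0 : Phase d) (r / 2)
  have hB' : B' ⊆ B := Metric.ball_subset_ball (by linarith)
  have hvol : volume B = 2 ^ d * volume B' := by
    have := Measure.addHaar_ball_mul_of_pos (volume : Measure (Phase d)) 0
      (two_pos (α := ℝ)) (r / 2)
    rw [mul_div_cancel₀ _ (two_ne_zero)] at this
    rw [this, finrank_euclideanSpace_fin, ENNReal.ofReal_pow zero_le_two, ENNReal.ofReal_ofNat]
  have h0 : volume B' ≠ 0 := (Metric.measure_ball_pos _ _ (by linarith)).ne'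
  have hfin : volume B' ≠ ∞ := measure_ball_lt_top.ne
  have hshift : ∫⁻ h in B', N (k + h) ≤ ∫⁻ h in B, N h := by
    rw [← lintegral_indicator measurableSet_ball, ← lintegral_indicator measurableSet_ball,
      ← lintegral_add_left_eq_self (B.indicator N) k]
    refine lintegral_mono fun h => ?_
    by_cases hh : h ∈ B'
    · have : k + h ∈ B := by
        simp only [B, B', mem_ball_zero_iff] at hh ⊢
        exact (norm_add_le _ _).trans_lt (by linarith)
      rw [indicator_of_mem hh, indicator_of_mem this]
    · rw [indicator_of_notMem hh]; exact zero_le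
  -- averaging over `h ∈ B'` keeps both `h` and `k + h` in `B`
  have key : N k * volume B' ≤ 4 * ∫⁻ h in B, N h := by
    calc N k * volume B' = ∫⁻ _ in B', N k := (setLIntegral_const _ _).symm
      _ ≤ ∫⁻ h in B', 2 * (N (k + h) + N h) :=
        lintegral_mono fun h => squareIncrement_le u (toTorus k) (toTorus h)
      _ = 2 * ((∫⁻ h in B', N (k + h)) + ∫⁻ h in B', N h) := by
        rw [lintegral_const_mul _ (by fun_prop), lintegral_add_left (by fun_prop)]
      _ ≤ 2 * ((∫⁻ h in B, N h) + ∫⁻ h in B, N h) := by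
        exact mul_le_mul_right (add_le_add hshift (lintegral_mono_set hB')) _
      _ = 4 * ∫⁻ h in B, N h := by rw [← two_mul, ← mul_assoc]; norm_num
  rw [meanSquareIncrement_eq, setLAverage_eq, hvol]
  have e : 4 * 2 ^ d * ((∫⁻ h in B, N h) / (2 ^ d * volume B')) =
      (4 * ∫⁻ h in B, N h) / volume B' := by
    rw [div_eq_mul_inv, div_eq_mul_inv, ENNReal.mul_inv (by simp) (by simp)]
    calc 4 * 2 ^ d * ((∫⁻ h in B, N h) * ((2 ^ d)⁻¹ * (volume B')⁻¹))
        = (4 * ∫⁻ h in B, N h) * (volume B')⁻¹ * (2 ^ d * (2 ^ d)⁻¹) := by ring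
      _ = _ := by rw [ENNReal.mul_inv_cancel (by simp) (by simp), mul_one]
  refine le_of_le_of_eq ?_ e.symm
  rw [ENNReal.le_div_iff_mul_le (Or.inl h0) (Or.inl hfin)]
  exact key

/-- The quotient map to the torus is open, so displacements from a small ball of `ℝ^d` fill a
neighbourhood of `0` in the torus. -/
theorem toTorus_image_ball_mem_nhds {r : ℝ} (hr : 0 < r) :
    toTorus '' Metric.ball (0 : Phase d) r ∈ 𝓝 (0 : Torus d) := by
  have hopen : IsOpenMap (toTorus : Phase d → Torus d) := by
    have h1 : IsOpenMap fun (f : Fin d → ℝ) (i : Fin d) => (f i : AddCircle (2 * Real.pi)) := 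
      IsOpenMap.piMap (fun _ => QuotientAddGroup.isOpenMap_coe) (by
        exact Filter.Eventually.of_forall fun i => QuotientAddGroup.mk_surjective)
    exact h1.comp (EuclideanSpace.equiv (Fin d) ℝ).toHomeomorph.isOpenMap
  exact hopen.image_mem_nhds (x := 0) (Metric.ball_mem_nhds _ hr)

end Increments

/-! ### Smoothing by convolution -/

section Smoothing

variable {d : ℕ}

theorem integrable_L2x (u : L2x d) : Integrable (u : Torus d → Phase d) :=
  (Lp.memLp u).integrable one_le_two

theorem integrable_kernel_smul (q : C(Torus d, ℝ)) (u : L2x d) (x : Torus d) :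
    Integrable fun y => q (y - x) • u y :=
  (integrable_L2x u).bdd_smul ‖q‖ (by fun_prop)
    (ae_of_all _ fun y => q.norm_coe_le_norm _)

/-- The smoothing `x ↦ ∫ q(y - x) u(y) dy` of `u` with the kernel `q`. -/
noncomputable def smoothFun (q : C(Torus d, ℝ)) (u : L2x d) : C(Torus d, Phase d) where
  toFun x := ∫ y, q (y - x) • u y
  continuous_toFun := by
    refine continuous_of_dominated (bound := fun y => ‖q‖ * ‖u y‖)
      (fun x => (integrable_kernel_smul q u x).aestronglyMeasurable)
      (fun x => ae_of_all _ fun y => ?_) ((integrable_L2x u).norm.const_mul _)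
      (ae_of_all _ fun y => by fun_prop)
    rw [norm_smul]
    exact mul_le_mul_of_nonneg_right (q.norm_coe_le_norm _) (norm_nonneg _)

theorem smoothFun_apply (q : C(Torus d, ℝ)) (u : L2x d) (x : Torus d) :
    smoothFun q u x = ∫ y, q (y - x) • u y := rfl

/-- Smoothing with the kernel `q` as a linear operator on `L²`. -/
noncomputable def smoothOp (q : C(Torus d, ℝ)) : L2x d →ₗ[ℝ] L2x d where
  toFun u := ContinuousMap.toLp 2 volume ℝ (smoothFun q u)
  map_add' u v := by
    rw [← map_add]
    congr 1
    ext1 x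
    rw [ContinuousMap.add_apply]
    simp_rw [smoothFun_apply]
    rw [← integral_add (integrable_kernel_smul q u x) (integrable_kernel_smul q v x)]
    refine integral_congr_ae ?_
    filter_upwards [Lp.coeFn_add u v] with y hy
    rw [hy, Pi.add_apply, smul_add]
  map_smul' c u := by
    rw [RingHom.id_apply, ← map_smul]
    congr 1
    ext1 x
    rw [ContinuousMap.smul_apply]
    simp_rw [smoothFun_apply]
    rw [← integral_smul]
    refine integral_congr_ae ?_
    filter_upwards [Lp.coeFn_smul c u] with y hy
    rw [hy, Pi.smul_apply, smul_comm]

theorem coeFn_smoothOp (q : C(Torus d, ℝ)) (u : L2x d) :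
    smoothOp q u =ᵐ[volume] smoothFun q u :=
  ContinuousMap.coeFn_toLp (𝕜 := ℝ) _ _

/-- The square root of the volume of the torus. -/
noncomputable def sqrtVol (d : ℕ) : ℝ :=
  (measureUnivNNReal (volume : Measure (Torus d)) : ℝ) ^ ((2 : ℝ≥0∞).toReal)⁻¹

theorem sqrtVol_nonneg (d : ℕ) : 0 ≤ sqrtVol d := by unfold sqrtVol; positivity

theorem norm_le_sqrtVol_mul {f : L2x d} {C : ℝ} (hC : 0 ≤ C) (h : ∀ᵐ x, ‖f x‖ ≤ C) :
    ‖f‖ ≤ sqrtVol d * C :=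
  Lp.norm_le_of_ae_bound hC h

theorem integral_norm_le (u : L2x d) : ∫ x, ‖u x‖ ≤ sqrtVol d * ‖u‖ := by
  have h := eLpNorm_le_eLpNorm_mul_rpow_measure_univ (μ := (volume : Measure (Torus d)))
    (p := 1) (q := 2) one_le_two (Lp.aestronglyMeasurable u)
  have e : (∫ x, ‖u x‖) = (eLpNorm u 1 volume).toReal := by
    rw [eLpNorm_one_eq_lintegral_enorm, integral_norm_eq_lintegral_enorm
      (Lp.aestronglyMeasurable u)]
  rw [e, Lp.norm_def, mul_comm (sqrtVol d)]
  refine (ENNReal.toReal_mono (ENNReal.mul_ne_top (Lp.eLpNorm_ne_top u)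
    (ENNReal.rpow_ne_top_of_nonneg (by norm_num) (measure_ne_top _ _))) h).trans_eq ?_
  have hv : (measureUnivNNReal (volume : Measure (Torus d)) : ℝ) = (volume univ).toReal := rfl
  rw [ENNReal.toReal_mul, ← ENNReal.toReal_rpow, sqrtVol, hv]
  norm_num

/-- The smoothing operator depends continuously, in operator norm, on the kernel in the uniform
norm. -/
theorem norm_smoothOp_sub_le (q q' : C(Torus d, ℝ)) (u : L2x d) :
    ‖smoothOp q u - smoothOp q' u‖ ≤ sqrtVol d * (‖q - q'‖ * (sqrtVol d * ‖u‖)) := by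
  have := sqrtVol_nonneg d
  refine norm_le_sqrtVol_mul (by positivity) ?_
  filter_upwards [Lp.coeFn_sub (smoothOp q u) (smoothOp q' u), coeFn_smoothOp q u,
    coeFn_smoothOp q' u] with x h₁ h₂ h₃
  rw [h₁, Pi.sub_apply, h₂, h₃, smoothFun_apply, smoothFun_apply,
    ← integral_sub (integrable_kernel_smul q u x) (integrable_kernel_smul q' u x)]
  refine (norm_integral_le_integral_norm _).trans ?_
  calc ∫ y, ‖q (y - x) • u y - q' (y - x) • u y‖
      ≤ ∫ y, ‖q - q'‖ * ‖u y‖ := by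
        refine integral_mono ((integrable_kernel_smul q u x).sub
          (integrable_kernel_smul q' u x)).norm ((integrable_L2x u).norm.const_mul _) fun y => ?_
        rw [← sub_smul, norm_smul]
        exact mul_le_mul_of_nonneg_right ((q - q').norm_coe_le_norm _) (norm_nonneg _)
    _ = ‖q - q'‖ * ∫ y, ‖u y‖ := integral_const_mul _ _
    _ ≤ _ := mul_le_mul_of_nonneg_left (integral_norm_le u) (norm_nonneg _)

theorem continuous_smoothOp (q : C(Torus d, ℝ)) : Continuous (smoothOp q) := by
  refine AddMonoidHomClass.continuous_of_bound (smoothOp q)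
    (sqrtVol d * (‖q‖ * sqrtVol d)) fun u => ?_
  have h0 : smoothOp (0 : C(Torus d, ℝ)) u = 0 := by
    have : smoothFun (0 : C(Torus d, ℝ)) u = 0 := by
      ext1 x; simp [smoothFun_apply]
    change ContinuousMap.toLp 2 volume ℝ (smoothFun 0 u) = 0
    rw [this, map_zero]
  have := norm_smoothOp_sub_le q 0 u
  rw [h0, sub_zero, sub_zero] at this
  refine this.trans_eq ?_
  ring

/-- Smoothing with a probability density changes `u` by at most the largest increment of `u` over
the displacements in the support of the density. -/
theorem enorm_sub_smoothOp_sq_le {b : C(Torus d, ℝ)} (hb : ∀ y, 0 ≤ b y) (hb1 : ∫ y, b y = 1)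
    (u : L2x d) {K : ℝ≥0∞} (hK : ∀ y, b y ≠ 0 → squareIncrement u y ≤ K) :
    ‖u - smoothOp b u‖ₑ ^ 2 ≤ K := by
  have hu := measurable_coe_L2x u
  -- the density `b` as a probability measure, so that `Lᵖ` norms increase with `p`
  let ρ : Measure (Torus d) := volume.withDensity fun y => ENNReal.ofReal (b y)
  have hbint : Integrable b := b.continuous.integrable_of_hasCompactSupport
    (HasCompactSupport.of_compactSpace _)
  have hbm : Measurable fun y => ENNReal.ofReal (b y) := by fun_prop
  have hρ : IsProbabilityMeasure ρ := ⟨by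
    rw [withDensity_apply _ MeasurableSet.univ, setLIntegral_univ,
      ← ofReal_integral_eq_lintegral_ofReal hbint (ae_of_all _ hb), hb1, ENNReal.ofReal_one]⟩
  have hpt : ∀ᵐ x, ‖(u - smoothOp b u) x‖ₑ ^ 2 ≤ ∫⁻ y, ‖u (x + y) - u x‖ₑ ^ 2 ∂ρ := by
    filter_upwards [Lp.coeFn_sub u (smoothOp b u), coeFn_smoothOp b u] with x h₁ h₂
    have hshift : smoothFun b u x = ∫ y, b y • u (x + y) := by
      rw [smoothFun_apply, ← integral_add_left_eq_self (fun y => b (y - x) • u y) x]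
      simp
    have hint : Integrable fun y => b y • u (x + y) := by
      have := (integrable_kernel_smul b u x).comp_add_left x
      simpa using this
    have hone : u x = ∫ y, b y • u x := by rw [integral_smul_const, hb1, one_smul]
    rw [h₁, Pi.sub_apply, h₂, hshift]
    nth_rw 1 [hone]
    rw [← integral_sub (hbint.smul_const _) hint]
    have h1 : ‖∫ y, (b y • u x - b y • u (x + y))‖ₑ ≤ ∫⁻ y, ‖u (x + y) - u x‖ₑ ∂ρ := by
      refine (enorm_integral_le_lintegral_enorm _).trans_eq ?_
      rw [lintegral_withDensity_eq_lintegral_mul _ hbm (by fun_prop)]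
      refine lintegral_congr fun y => ?_
      rw [← smul_sub, enorm_smul, Pi.mul_apply, Real.enorm_eq_ofReal (hb y), ← enorm_neg, neg_sub]
    have h2 := eLpNorm_le_eLpNorm_of_exponent_le (μ := ρ) (p := 1) (q := 2) one_le_two
      (f := fun y => u (x + y) - u x)
      (by exact (Measurable.aestronglyMeasurable (by fun_prop)))
    rw [eLpNorm_one_eq_lintegral_enorm] at h2
    refine (pow_le_pow_left' (h1.trans h2) 2).trans_eq ?_
    rw [eLpNorm_eq_lintegral_rpow_enorm_toReal (by simp) (by simp)]
    simp only [ENNReal.toReal_ofNat, one_div]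
    rw [← ENNReal.rpow_natCast, ← ENNReal.rpow_mul]
    norm_num
  have hnorm : ‖u - smoothOp b u‖ₑ ^ 2 = ∫⁻ x, ‖(u - smoothOp b u) x‖ₑ ^ 2 := by
    rw [Lp.enorm_def, eLpNorm_eq_lintegral_rpow_enorm_toReal (by simp) (by simp)]
    simp only [ENNReal.toReal_ofNat, one_div]
    rw [← ENNReal.rpow_natCast, ← ENNReal.rpow_mul]
    norm_num
  rw [hnorm]
  refine (lintegral_mono_ae hpt).trans ?_
  rw [lintegral_lintegral_swap (by fun_prop)]
  change ∫⁻ y, squareIncrement u y ∂ρ ≤ K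
  have hae : ∀ᵐ y ∂ρ, squareIncrement u y ≤ K := by
    rw [ae_withDensity_iff hbm]
    refine ae_of_all _ fun y hy => hK y fun h => hy ?_
    rw [h, ENNReal.ofReal_zero]
  refine (lintegral_mono_ae hae).trans_eq ?_
  simp

/-- A continuous probability density supported in a given neighbourhood of `0`. -/
theorem exists_bump {U : Set (Torus d)} (hU : U ∈ 𝓝 (0 : Torus d)) :
    ∃ b : C(Torus d, ℝ), (∀ y, 0 ≤ b y) ∧ ∫ y, b y = 1 ∧ ∀ y, b y ≠ 0 → y ∈ U := by
  obtain ⟨V, hVU, hV, h0V⟩ := mem_nhds_iff.1 hU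
  obtain ⟨f, hf0, hf1, hf⟩ := exists_continuous_zero_one_of_isClosed hV.isClosed_compl
    (isClosed_singleton (x := (0 : Torus d))) (by simpa using h0V)
  have hfint : Integrable f := f.continuous.integrable_of_hasCompactSupport
    (HasCompactSupport.of_compactSpace _)
  have hpos : 0 < ∫ y, f y := by
    refine integral_pos_of_integrable_nonneg_nonzero (x := 0) f.continuous hfint
      (fun y => (hf y).1) ?_
    rw [hf1 (mem_singleton _)]; exact one_ne_zero
  refine ⟨(∫ y, f y)⁻¹ • f, fun y => mul_nonneg (inv_nonneg.2 hpos.le) (hf y).1, ?_, fun y hy => ?_⟩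
  · simp only [ContinuousMap.coe_smul, Pi.smul_apply, smul_eq_mul, integral_const_mul]
    exact inv_mul_cancel₀ hpos.ne'
  · by_contra h
    refine hy ?_
    have : f y = 0 := hf0 fun hyV => h (hVU hyV)
    simp [this]

end Smoothing

/-! ### Trigonometric kernels and the norm of `H^{-L}` -/

section TrigonometricKernels

variable {d : ℕ}

/-- The character `x ↦ e^{i n·x}` of the torus. -/
noncomputable def torusChar (n : Fin d → ℤ) : C(Torus d, ℂ) where
  toFun x := ∏ i, fourier (n i) (x i)
  continuous_toFun := by fun_prop

theorem torusChar_apply (n : Fin d → ℤ) (x : Torus d) :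
    torusChar n x = ∏ i, fourier (n i) (x i) := rfl

theorem torusChar_neg (n : Fin d → ℤ) (x : Torus d) :
    torusChar (-n) x = starRingEnd ℂ (torusChar n x) := by
  simp only [torusChar_apply, Pi.neg_apply, fourier_neg, map_prod]

theorem torusChar_sub_apply (n : Fin d → ℤ) (x y : Torus d) :
    torusChar n (y - x) = torusChar n y * torusChar n (-x) := by
  simp only [torusChar_apply, ← Finset.prod_mul_distrib]
  refine Finset.prod_congr rfl fun i _ => ?_
  simp only [fourier_apply, Pi.sub_apply, Pi.neg_apply, sub_eq_add_neg, smul_add,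
    AddCircle.toCircle_add, Circle.coe_mul]

theorem norm_torusChar_apply (n : Fin d → ℤ) (x : Torus d) : ‖torusChar n x‖ = 1 := by
  rw [torusChar_apply, norm_prod]
  exact Finset.prod_eq_one fun i _ => Circle.norm_coe _

theorem torusChar_single (x : Torus d) (i : Fin d) :
    torusChar (Pi.single i 1) x = fourier 1 (x i) := by
  rw [torusChar_apply, Finset.prod_eq_single i]
  · rw [Pi.single_eq_same]
  · intro j _ hj
    rw [Pi.single_eq_of_ne hj, fourier_zero]
  · simp

/-- The star subalgebra generated by the characters. -/
noncomputable def torusCharSubalgebra (d : ℕ) : StarSubalgebra ℂ C(Torus d, ℂ) where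
  toSubalgebra := Algebra.adjoin ℂ (range torusChar)
  star_mem' := by
    change Algebra.adjoin ℂ (range torusChar) ≤ star (Algebra.adjoin ℂ (range torusChar))
    refine Algebra.adjoin_le ?_
    rintro _ ⟨n, rfl⟩
    refine Algebra.subset_adjoin ⟨-n, ?_⟩
    ext1 x
    simp only [torusChar_neg, starRingEnd_apply, ContinuousMap.star_apply]

theorem torusCharSubalgebra_coe :
    (torusCharSubalgebra d).toSubalgebra.toSubmodule = Submodule.span ℂ (range torusChar) := by
  apply Algebra.adjoin_eq_span_of_subset
  refine .trans (fun x ↦ Submonoid.closure_induction (fun _ ↦ id) ⟨0, ?_⟩ ?_)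
    Submodule.subset_span
  · ext z
    simp [torusChar_apply]
  · rintro _ _ _ _ ⟨m, rfl⟩ ⟨n, rfl⟩
    refine ⟨m + n, ?_⟩
    ext z
    simp only [torusChar_apply, ContinuousMap.mul_apply, Pi.add_apply, fourier_add,
      Finset.prod_mul_distrib]

theorem torusCharSubalgebra_separatesPoints :
    (torusCharSubalgebra d).SeparatesPoints := by
  intro x y hxy
  obtain ⟨i, hi⟩ := Function.ne_iff.1 hxy
  refine ⟨_, ⟨torusChar (Pi.single i 1), Algebra.subset_adjoin ⟨Pi.single i 1, rfl⟩, rfl⟩, ?_⟩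
  change torusChar _ x ≠ torusChar _ y
  rw [torusChar_single, torusChar_single, fourier_one, fourier_one]
  exact fun h => hi (AddCircle.injective_toCircle Real.two_pi_pos.ne' (Circle.ext h))

/-- The trigonometric polynomials are uniformly dense, by the Stone–Weierstrass theorem. -/
theorem mem_closure_span_torusChar (f : C(Torus d, ℂ)) :
    f ∈ closure (Submodule.span ℂ (range (torusChar (d := d))) : Set C(Torus d, ℂ)) := by
  have h := ContinuousMap.starSubalgebra_topologicalClosure_eq_top_of_separatesPoints
    (torusCharSubalgebra d) torusCharSubalgebra_separatesPoints
  have hf : f ∈ (torusCharSubalgebra d).topologicalClosure := h ▸ trivial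
  rw [← torusCharSubalgebra_coe]
  exact hf

/-- The total size of the Fourier coefficients of `u` with frequency in `S`. -/
noncomputable def lowFrequencyNorm (S : Finset (Fin d → ℤ)) (u : L2x d) : ℝ :=
  ∑ k ∈ S, ∑ j, ‖fourierCoef u k j‖

theorem lowFrequencyNorm_mono {S S' : Finset (Fin d → ℤ)} (h : S ⊆ S') (u : L2x d) :
    lowFrequencyNorm S u ≤ lowFrequencyNorm S' u :=
  Finset.sum_le_sum_of_subset_of_nonneg h fun _ _ _ => by positivity

theorem integrable_component (u : L2x d) (j : Fin d) :
    Integrable fun y => ((u y j : ℝ) : ℂ) :=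
  (((EuclideanSpace.proj (𝕜 := ℝ) j).integrable_comp (integrable_L2x u))).ofReal

theorem integrable_mul_component (p : C(Torus d, ℂ)) (u : L2x d) (x : Torus d) (j : Fin d) :
    Integrable fun y => p (y - x) * ((u y j : ℝ) : ℂ) :=
  (integrable_component u j).bdd_mul (c := ‖p‖)
    (Continuous.aestronglyMeasurable (by fun_prop))
    (ae_of_all _ fun y => p.norm_coe_le_norm _)

/-- `fourierCoef` pairs with the character of frequency `-k` and is normalised by the volume. -/
theorem fourierCoef_eq (u : L2x d) (k : Fin d → ℤ) (j : Fin d) :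
    ∫ y, torusChar (-k) y * ((u y j : ℝ) : ℂ) = ((2 * Real.pi) ^ d : ℝ) * fourierCoef u k j := by
  have h : ((2 * Real.pi) ^ d : ℝ) ≠ 0 := by positivity
  rw [fourierCoef, Complex.real_smul, ← mul_assoc, ← Complex.ofReal_mul, mul_inv_cancel₀ h,
    Complex.ofReal_one, one_mul]
  rfl

/-- Smoothing with a trigonometric polynomial depends on finitely many Fourier coefficients. -/
theorem exists_bound_of_mem_span {p : C(Torus d, ℂ)}
    (hp : p ∈ Submodule.span ℂ (range (torusChar (d := d)))) :
    ∃ (S : Finset (Fin d → ℤ)) (C : ℝ), 0 ≤ C ∧ ∀ (u : L2x d) (x : Torus d) (j : Fin d),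
      ‖∫ y, p (y - x) * ((u y j : ℝ) : ℂ)‖ ≤ C * lowFrequencyNorm S u := by
  classical
  induction hp using Submodule.span_induction with
  | mem p hp =>
    obtain ⟨n, rfl⟩ := hp
    refine ⟨{-n}, (2 * Real.pi) ^ d, by positivity, fun u x j => ?_⟩
    have e : ∫ y, torusChar n (y - x) * ((u y j : ℝ) : ℂ) =
        torusChar n (-x) * (((2 * Real.pi) ^ d : ℝ) * fourierCoef u (-n) j) := by
      rw [← fourierCoef_eq, neg_neg, ← integral_const_mul]
      refine integral_congr_ae (ae_of_all _ fun y => ?_)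
      simp only [torusChar_sub_apply]
      ring
    rw [e, norm_mul, norm_torusChar_apply, one_mul, norm_mul, Complex.norm_real,
      Real.norm_of_nonneg (by positivity), lowFrequencyNorm, Finset.sum_singleton]
    gcongr
    exact Finset.single_le_sum (f := fun j => ‖fourierCoef u (-n) j‖)
      (fun _ _ => norm_nonneg _) (Finset.mem_univ j)
  | zero => exact ⟨∅, 0, le_rfl, fun u x j => by simp⟩
  | add p p' _ _ ih ih' =>
    obtain ⟨S, C, hC, h⟩ := ih
    obtain ⟨S', C', hC', h'⟩ := ih'
    refine ⟨S ∪ S', C + C', add_nonneg hC hC', fun u x j => ?_⟩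
    simp_rw [ContinuousMap.add_apply, add_mul]
    rw [integral_add (integrable_mul_component p u x j) (integrable_mul_component p' u x j)]
    refine (norm_add_le _ _).trans (add_le_add ?_ ?_)
    · exact (h u x j).trans (mul_le_mul_of_nonneg_left
        (lowFrequencyNorm_mono Finset.subset_union_left u) hC)
    · exact (h' u x j).trans (mul_le_mul_of_nonneg_left
        (lowFrequencyNorm_mono Finset.subset_union_right u) hC')
  | smul c p _ ih =>
    obtain ⟨S, C, hC, h⟩ := ih
    refine ⟨S, ‖c‖ * C, by positivity, fun u x j => ?_⟩
    simp_rw [ContinuousMap.smul_apply, smul_eq_mul, mul_assoc]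
    rw [integral_const_mul, norm_mul]
    exact mul_le_mul_of_nonneg_left (h u x j) (norm_nonneg c)

/-- The real part of a complex kernel. -/
noncomputable def reKernel (p : C(Torus d, ℂ)) : C(Torus d, ℝ) where
  toFun x := (p x).re
  continuous_toFun := by fun_prop

theorem smoothFun_reKernel_apply (p : C(Torus d, ℂ)) (u : L2x d) (x : Torus d) (j : Fin d) :
    smoothFun (reKernel p) u x j = (∫ y, p (y - x) * ((u y j : ℝ) : ℂ)).re := by
  have h1 := ((EuclideanSpace.proj (𝕜 := ℝ) j).integral_comp_comm
    (integrable_kernel_smul (reKernel p) u x)).symm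
  have h2 := (Complex.reCLM.integral_comp_comm (integrable_mul_component p u x j)).symm
  refine h1.trans (Eq.trans ?_ h2.symm)
  refine integral_congr_ae (ae_of_all _ fun y => ?_)
  simp [reKernel]

theorem exists_norm_smoothOp_le {p : C(Torus d, ℂ)}
    (hp : p ∈ Submodule.span ℂ (range (torusChar (d := d)))) :
    ∃ (S : Finset (Fin d → ℤ)) (C : ℝ), 0 ≤ C ∧ ∀ u : L2x d,
      ‖smoothOp (reKernel p) u‖ ≤ C * lowFrequencyNorm S u := by
  obtain ⟨S, C, hC, h⟩ := exists_bound_of_mem_span hp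
  have hs := sqrtVol_nonneg d
  refine ⟨S, sqrtVol d * (d * C), by positivity, fun u => ?_⟩
  have hl : 0 ≤ lowFrequencyNorm S u := by unfold lowFrequencyNorm; positivity
  rw [mul_assoc]
  refine norm_le_sqrtVol_mul (by positivity) ?_
  filter_upwards [coeFn_smoothOp (reKernel p) u] with x hx
  rw [hx]
  calc ‖smoothFun (reKernel p) u x‖ ≤ ∑ j, ‖smoothFun (reKernel p) u x j‖ := by
        rw [EuclideanSpace.norm_eq]
        refine Real.sqrt_le_iff.2 ⟨by positivity, ?_⟩
        exact Finset.sum_sq_le_sq_sum_of_nonneg fun _ _ => norm_nonneg _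
    _ ≤ ∑ _j : Fin d, C * lowFrequencyNorm S u := by
        refine Finset.sum_le_sum fun j _ => ?_
        rw [smoothFun_reKernel_apply]
        exact (Complex.abs_re_le_norm _).trans (h u x j)
    _ = d * C * lowFrequencyNorm S u := by simp [mul_assoc]

theorem exists_trigonometric_approx (b : C(Torus d, ℝ)) {ε : ℝ} (hε : 0 < ε) :
    ∃ p ∈ Submodule.span ℂ (range (torusChar (d := d))), ‖b - reKernel p‖ ≤ ε := by
  let f : C(Torus d, ℂ) := ⟨fun x => (b x : ℂ), by fun_prop⟩
  obtain ⟨p, hp, hfp⟩ := Metric.mem_closure_iff.1 (mem_closure_span_torusChar f) ε hε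
  refine ⟨p, hp, (ContinuousMap.norm_le _ hε.le).2 fun x => ?_⟩
  have h : ‖(f - p) x‖ ≤ ε :=
    ((f - p).norm_coe_le_norm x).trans (by rw [← dist_eq_norm]; exact hfp.le)
  refine le_trans ?_ h
  have := Complex.abs_re_le_norm ((f - p) x)
  simpa [f, reKernel] using this

/-- A single Fourier coefficient is one term of the series that defines the norm of `H^{-L}`; the
constant grows with the frequency. -/
theorem enorm_fourierCoef_le {L : ℝ} (k : Fin d → ℤ) :
    ∃ C : ℝ≥0∞, C ≠ ∞ ∧ ∀ (u : L2x d) (j : Fin d),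
      ‖fourierCoef u k j‖ₑ ≤ C * negSobolevNorm L u := by
  set c : ℝ≥0∞ := ENNReal.ofReal ((2 * Real.pi) ^ d) *
    ENNReal.ofReal ((1 + ∑ i, (k i : ℝ) ^ 2) ^ (-L)) with hc
  have hpos : 0 < 1 + ∑ i, (k i : ℝ) ^ 2 := by positivity
  have hc0 : c ≠ 0 := mul_ne_zero (by simpa using by positivity)
    (by simpa using Real.rpow_pos_of_pos hpos _)
  have hct : c ≠ ∞ := ENNReal.mul_ne_top ENNReal.ofReal_ne_top ENNReal.ofReal_ne_top
  refine ⟨(c ^ (1 / 2 : ℝ))⁻¹, ?_, fun u j => ?_⟩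
  · rw [ENNReal.inv_ne_top]
    exact (ENNReal.rpow_pos (pos_iff_ne_zero.2 hc0) hct).ne'
  have h1 : c * ‖fourierCoef u k j‖ₑ ^ 2 ≤ ENNReal.ofReal ((2 * Real.pi) ^ d) *
      ∑' k : Fin d → ℤ, ENNReal.ofReal ((1 + ∑ i, (k i : ℝ) ^ 2) ^ (-L)) *
        ∑ j, ‖fourierCoef u k j‖ₑ ^ 2 := by
    rw [hc, mul_assoc]
    refine mul_le_mul_right ?_ _
    refine le_trans ?_ (ENNReal.le_tsum k)
    exact mul_le_mul_right (Finset.single_le_sum (f := fun j => ‖fourierCoef u k j‖ₑ ^ 2)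
      (fun _ _ => zero_le) (Finset.mem_univ j)) _
  have h2 : c ^ (1 / 2 : ℝ) * ‖fourierCoef u k j‖ₑ ≤ negSobolevNorm L u := by
    have := ENNReal.rpow_le_rpow h1 (by norm_num : (0 : ℝ) ≤ 1 / 2)
    rw [ENNReal.mul_rpow_of_nonneg _ _ (by norm_num), ← ENNReal.rpow_natCast,
      ← ENNReal.rpow_mul] at this
    norm_num at this ⊢
    exact this
  rw [mul_comm, ← div_eq_mul_inv]
  have h3 : c ^ (1 / 2 : ℝ) ≠ 0 := (ENNReal.rpow_pos (pos_iff_ne_zero.2 hc0) hct).ne'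
  have h4 : c ^ (1 / 2 : ℝ) ≠ ∞ := ENNReal.rpow_ne_top_of_nonneg (by norm_num) hct
  rw [ENNReal.le_div_iff_mul_le (Or.inl h3) (Or.inl h4), mul_comm]
  exact h2

theorem ofReal_lowFrequencyNorm_le (L : ℝ) (S : Finset (Fin d → ℤ)) :
    ∃ C : ℝ≥0∞, C ≠ ∞ ∧ ∀ u : L2x d,
      ENNReal.ofReal (lowFrequencyNorm S u) ≤ C * negSobolevNorm L u := by
  choose C hC h using fun k : Fin d → ℤ => enorm_fourierCoef_le (L := L) k
  refine ⟨∑ k ∈ S, ∑ _j : Fin d, C k, ?_, fun u => ?_⟩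
  · exact ENNReal.sum_ne_top.2 fun k _ => ENNReal.sum_ne_top.2 fun _ _ => hC k
  · rw [lowFrequencyNorm, ENNReal.ofReal_sum_of_nonneg fun _ _ => by positivity, Finset.sum_mul]
    refine Finset.sum_le_sum fun k _ => ?_
    rw [ENNReal.ofReal_sum_of_nonneg fun _ _ => by positivity, Finset.sum_mul]
    refine Finset.sum_le_sum fun j _ => ?_
    rw [ofReal_norm]
    exact h k u j

end TrigonometricKernels

/-! ### Total boundedness and smoothing operators -/

section Precompactness

/-- A family is totally bounded if, up to any given precision, its members are determined by the
approximate value of a totally bounded code. -/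
theorem totallyBounded_range_of_codes {ι α : Type*} [PseudoEMetricSpace α] {x : ι → α}
    (h : ∀ ε : ℝ≥0∞, 0 < ε → ∃ (Z : Type) (_ : PseudoEMetricSpace Z) (c : ι → Z),
      TotallyBounded (range c) ∧ ∃ δ : ℝ≥0∞, 0 < δ ∧
        ∀ i j, edist (c i) (c j) < δ → edist (x i) (x j) < ε) :
    TotallyBounded (range x) := by
  refine EMetric.totallyBounded_iff.2 fun ε hε => ?_
  obtain ⟨Z, _, c, hc, δ, hδ, hcx⟩ := h ε hε
  obtain ⟨t, htc, htf, ht⟩ := EMetric.totallyBounded_iff'.1 hc δ hδ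
  rw [← image_univ] at htc
  obtain ⟨t', -, ht'f, rfl⟩ := exists_subset_image_finite_and.1 ⟨t, htc, htf, rfl⟩
  refine ⟨x '' t', ht'f.image x, ?_⟩
  rintro _ ⟨i, rfl⟩
  obtain ⟨_, ⟨j, hj, rfl⟩, hij⟩ := mem_iUnion₂.1 (ht (mem_range_self i))
  exact mem_iUnion₂.2 ⟨x j, mem_image_of_mem x hj, hcx i j hij⟩

variable {d : ℕ}

theorem fourierCoef_sub (u v : L2x d) (k : Fin d → ℤ) (j : Fin d) :
    fourierCoef (u - v) k j = fourierCoef u k j - fourierCoef v k j := by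
  have hint : ∀ w : L2x d, Integrable fun y => torusChar (-k) y * ((w y j : ℝ) : ℂ) := fun w => by
    simpa using integrable_mul_component (torusChar (-k)) w 0 j
  have h : ((((2 * Real.pi) ^ d : ℝ) : ℝ) : ℂ) ≠ 0 := by
    exact_mod_cast (by positivity : ((2 * Real.pi) ^ d : ℝ) ≠ 0)
  refine mul_left_cancel₀ h ?_
  rw [mul_sub, ← fourierCoef_eq, ← fourierCoef_eq, ← fourierCoef_eq,
    ← integral_sub (hint u) (hint v)]
  refine integral_congr_ae ?_
  filter_upwards [Lp.coeFn_sub u v] with y hy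
  simp only [hy, Pi.sub_apply, PiLp.sub_apply, Complex.ofReal_sub, mul_sub]

theorem norm_fourierCoef_le (u : L2x d) (k : Fin d → ℤ) (j : Fin d) :
    ‖fourierCoef u k j‖ ≤ ((2 * Real.pi) ^ d)⁻¹ * (sqrtVol d * ‖u‖) := by
  rw [fourierCoef, norm_smul, Real.norm_of_nonneg (by positivity)]
  refine mul_le_mul_of_nonneg_left ?_ (by positivity)
  refine (norm_integral_le_of_norm_le (integrable_L2x u).norm (ae_of_all _ fun y => ?_)).trans
    (integral_norm_le u)
  have h : ‖torusChar (-k) y * ((u y j : ℝ) : ℂ)‖ ≤ ‖u y‖ := by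
    rw [norm_mul, norm_torusChar_apply, one_mul, Complex.norm_real]
    exact PiLp.norm_apply_le (u y) j
  exact h

/-- The finitely many Fourier coefficients that determine `smoothOp q u` range over a bounded set of
a finite-dimensional space. -/
theorem totallyBounded_smoothOp_range {q : C(Torus d, ℝ)} {S : Finset (Fin d → ℤ)} {C : ℝ}
    (hC : 0 ≤ C) (h : ∀ u : L2x d, ‖smoothOp q u‖ ≤ C * lowFrequencyNorm S u) (M : ℝ) :
    TotallyBounded (range fun u : Metric.ball (0 : L2x d) M => smoothOp q u.1) := by
  refine totallyBounded_range_of_codes fun ε hε => ?_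
  refine ⟨S → Fin d → ℂ, inferInstance, fun u k j => fourierCoef u.1 k.1 j, ?_, ?_⟩
  · have hs := sqrtVol_nonneg d
    refine (isCompact_closedBall (0 : S → Fin d → ℂ)
      (((2 * Real.pi) ^ d)⁻¹ * (sqrtVol d * |M|))).totallyBounded.subset ?_
    rintro _ ⟨u, rfl⟩
    rw [mem_closedBall_zero_iff, pi_norm_le_iff_of_nonneg (by positivity)]
    intro k
    rw [pi_norm_le_iff_of_nonneg (by positivity)]
    intro j
    refine (norm_fourierCoef_le u.1 k.1 j).trans ?_
    have : ‖u.1‖ ≤ |M| := (mem_ball_zero_iff.1 u.2).le.trans (le_abs_self M)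
    gcongr
  · set K : ℝ := C * (S.card * d) with hK
    have hK0 : 0 ≤ K := by positivity
    obtain ⟨δ, hδ, hδε⟩ := ENNReal.exists_nnreal_pos_mul_lt (a := ENNReal.ofReal K)
      ENNReal.ofReal_ne_top hε.ne'
    refine ⟨δ, by exact_mod_cast hδ, fun u v huv => ?_⟩
    refine lt_of_le_of_lt ?_ hδε
    have hdist : dist (smoothOp q u.1) (smoothOp q v.1) ≤ K * dist
        (fun (k : S) (j : Fin d) => fourierCoef u.1 k.1 j) (fun k j => fourierCoef v.1 k.1 j) := by
      rw [dist_eq_norm, ← map_sub]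
      refine (h _).trans ?_
      rw [hK, mul_assoc]
      refine mul_le_mul_of_nonneg_left ?_ hC
      rw [lowFrequencyNorm, ← Finset.sum_coe_sort, mul_assoc]
      refine (Finset.sum_le_card_nsmul _ _ (d * dist
        (fun (k : S) (j : Fin d) => fourierCoef u.1 k.1 j) (fun k j => fourierCoef v.1 k.1 j))
        fun k _ => ?_).trans_eq (by simp)
      refine (Finset.sum_le_card_nsmul _ _ (dist
        (fun (k : S) (j : Fin d) => fourierCoef u.1 k.1 j) (fun k j => fourierCoef v.1 k.1 j))
        fun j _ => ?_).trans_eq (by simp)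
      rw [fourierCoef_sub, ← dist_eq_norm]
      exact (dist_le_pi_dist (fun j => fourierCoef u.1 k.1 j) (fun j => fourierCoef v.1 k.1 j)
        j).trans (dist_le_pi_dist (fun (k : S) (j : Fin d) => fourierCoef u.1 k.1 j)
          (fun k j => fourierCoef v.1 k.1 j) k)
    rw [edist_dist]
    refine (ENNReal.ofReal_le_ofReal hdist).trans ?_
    rw [ENNReal.ofReal_mul hK0, ← edist_dist, mul_comm]
    exact mul_le_mul_left huv.le _

/-- Smoothing at a fixed scale: a linear operator that is close to the identity where the increments
are small, that is controlled by the norm of `H^{-L}`, and that maps balls to totally bounded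
sets. -/
theorem exists_smoothing (d : ℕ) (L M : ℝ) {r : ℝ} (hr : 0 < r) {η : ℝ} (hη : 0 < η) :
    ∃ F : L2x d →ₗ[ℝ] L2x d, Continuous F ∧
      (∀ u, ∃ w : ℝ≥0∞, w ^ 2 ≤ 4 * 2 ^ d * meanSquareIncrement r u ∧
        ‖u - F u‖ₑ ≤ w + ENNReal.ofReal η * ‖u‖ₑ) ∧
      (∃ C : ℝ≥0∞, C ≠ ∞ ∧ ∀ u, ‖F u‖ₑ ≤ C * negSobolevNorm L u) ∧
      TotallyBounded (range fun u : Metric.ball (0 : L2x d) M => F u.1) := by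
  obtain ⟨b, hb, hb1, hbs⟩ := exists_bump (toTorus_image_ball_mem_nhds (d := d) (half_pos hr))
  have hs := sqrtVol_nonneg d
  obtain ⟨p, hp, hbp⟩ := exists_trigonometric_approx b
    (ε := η / (sqrtVol d * sqrtVol d + 1)) (by positivity)
  obtain ⟨S, C, hC, hSC⟩ := exists_norm_smoothOp_le hp
  refine ⟨smoothOp (reKernel p), continuous_smoothOp _, fun u => ?_, ?_,
    totallyBounded_smoothOp_range hC hSC M⟩
  · refine ⟨‖u - smoothOp b u‖ₑ, enorm_sub_smoothOp_sq_le hb hb1 u fun y hy => ?_, ?_⟩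
    · obtain ⟨k, hk, rfl⟩ := hbs y hy
      exact squareIncrement_le_meanSquareIncrement hr u (mem_ball_zero_iff.1 hk)
    · have h1 : ‖smoothOp b u - smoothOp (reKernel p) u‖ ≤ η * ‖u‖ := by
        refine (norm_smoothOp_sub_le _ _ u).trans ?_
        have h2 : ‖b - reKernel p‖ * (sqrtVol d * sqrtVol d) ≤ η := by
          calc ‖b - reKernel p‖ * (sqrtVol d * sqrtVol d)
              ≤ η / (sqrtVol d * sqrtVol d + 1) * (sqrtVol d * sqrtVol d + 1) := by
                gcongr; linarith
            _ = η := div_mul_cancel₀ _ (by positivity)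
        calc sqrtVol d * (‖b - reKernel p‖ * (sqrtVol d * ‖u‖))
            = ‖b - reKernel p‖ * (sqrtVol d * sqrtVol d) * ‖u‖ := by ring
          _ ≤ η * ‖u‖ := by gcongr
      rw [← sub_add_sub_cancel u (smoothOp b u)]
      refine (enorm_add_le _ _).trans (add_le_add le_rfl ?_)
      rw [← ofReal_norm, ← ofReal_norm, ← ENNReal.ofReal_mul hη.le]
      exact ENNReal.ofReal_le_ofReal h1
  · obtain ⟨C', hC', hS⟩ := ofReal_lowFrequencyNorm_le (d := d) L S
    refine ⟨ENNReal.ofReal C * C', ENNReal.mul_ne_top ENNReal.ofReal_ne_top hC', fun u => ?_⟩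
    rw [← ofReal_norm, mul_assoc]
    refine (ENNReal.ofReal_le_ofReal (hSC u)).trans ?_
    rw [ENNReal.ofReal_mul hC]
    exact mul_le_mul_right (hS u) _

/-- A measurable map with totally bounded image of `s` is uniformly close on `s` to a simple
function. -/
theorem exists_simpleFunc_edist_le {X : Type*} [PseudoEMetricSpace X] [MeasurableSpace X]
    [BorelSpace X] [Nonempty X] {F : X → X} (hF : Measurable F) {s : Set X}
    (hs : TotallyBounded (range fun u : s => F u.1)) {ε : ℝ≥0∞} (hε : 0 < ε) :
    ∃ D : SimpleFunc X X, ∀ u ∈ s, edist (F u) (D u) ≤ ε := by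
  obtain ⟨t, htf, ht⟩ := EMetric.totallyBounded_iff.1 hs ε hε
  obtain ⟨x₀⟩ := ‹Nonempty X›
  let l : List X := htf.toFinset.toList
  let e : ℕ → X := fun k => l.getD k x₀
  refine ⟨(SimpleFunc.nearestPt e l.length).comp F hF, fun u hu => ?_⟩
  obtain ⟨y, hy, huy⟩ := mem_iUnion₂.1 (ht (mem_range_self (⟨u, hu⟩ : s)))
  have hyl : y ∈ l := by simpa [l] using hy
  obtain ⟨k, hk, hke⟩ := List.mem_iff_getElem.1 hyl
  have hek : e k = y := by simp only [e]; rw [List.getD_eq_getElem _ _ hk, hke]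
  have := SimpleFunc.edist_nearestPt_le e (F u) hk.le
  rw [hek] at this
  rw [edist_comm]
  refine le_trans this ?_
  rw [edist_comm]
  exact (Metric.mem_eball.1 huy).le

end Precompactness

/-! ### Total boundedness of the family -/

section FinalArgument

variable {d : ℕ} {T : ℝ}

instance isFiniteMeasure_timeMeasure (T : ℝ) : IsFiniteMeasure (timeMeasure T) := by
  unfold timeMeasure; infer_instance

theorem timeMeasure_univ (T : ℝ) : timeMeasure T univ = ENNReal.ofReal T := by
  simp [timeMeasure]

theorem edist_pushLaw_le_of_plan {X : Type*} [NormedAddCommGroup X] [MeasurableSpace X]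
    [BorelSpace X] [SecondCountableTopology X] [CompleteSpace X] {μ ν : ProbabilityMeasure X}
    {π : ProbabilityMeasure (X × X)} (hπ : IsTransferPlan π μ ν) {F : X → X} (hF : Measurable F) :
    edist (pushLaw μ hF) (pushLaw ν hF) ≤ ∫⁻ p, ‖F p.1 - F p.2‖ₑ ∂(π : Measure (X × X)) :=
  wasserstein1_le_lintegral (μ := μ.map hF.aemeasurable) (ν := ν.map hF.aemeasurable)
    (π : Measure (X × X)) (hF.comp measurable_fst) (hF.comp measurable_snd)
    (by rw [← Measure.map_map hF measurable_fst, hπ.1]; rfl)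
    (by rw [← Measure.map_map hF measurable_snd, hπ.2]; rfl)

/-- A replacement for the Cauchy–Schwarz inequality, which would need measurability in `u` of the
mean square increment. -/
theorem le_add_div_of_sq_le {w K σ : ℝ≥0∞} (h : w ^ 2 ≤ K) (hσ0 : σ ≠ 0) (hσ : σ ≠ ∞) :
    w ≤ σ + K / σ := by
  rcases le_total w σ with hw | hw
  · exact hw.trans le_self_add
  · refine le_trans ?_ le_add_self
    rw [ENNReal.le_div_iff_mul_le (Or.inl hσ0) (Or.inl hσ)]
    exact (mul_le_mul_right hw w).trans (by rwa [← sq])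

theorem lintegral_meanSquareIncrement_le {μ : TimeParamMeasure d T} {r : ℝ} {c : ℝ≥0∞}
    (h : structureFunction μ r ≤ c) :
    ∫⁻ t, ∫⁻ u, meanSquareIncrement r u ∂(μ.at_time t : Measure (L2x d)) ∂(timeMeasure T) ≤
      c ^ 2 := by
  have := pow_le_pow_left' h 2
  rwa [structureFunction, ← ENNReal.rpow_natCast, ← ENNReal.rpow_mul, Nat.cast_ofNat,
    one_div_mul_cancel two_ne_zero, ENNReal.rpow_one] at this

theorem ae_norm_lt {ρ : ProbabilityMeasure (L2x d)} {M : ℝ}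
    (h : (ρ : Measure (L2x d)) {u | ‖u‖ < M} = 1) : ∀ᵐ u ∂(ρ : Measure (L2x d)), ‖u‖ < M := by
  have hm : MeasurableSet {u : L2x d | ‖u‖ < M} := measurableSet_lt measurable_norm measurable_const
  exact (prob_compl_eq_zero_iff hm).2 h

/-- If smoothing displaces functions by little where their increments are small, it displaces a
time-parametrized measure by little when its structure function is small. -/
theorem lintegral_displacement_le {μ : TimeParamMeasure d T} {M : ℝ}
    (hball : ∀ᵐ t ∂(timeMeasure T), (μ.at_time t : Measure (L2x d)) {u | ‖u‖ < M} = 1)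
    {r : ℝ} {c : ℝ≥0∞} (hc : structureFunction μ r ≤ c) {F : L2x d → L2x d} {κ η : ℝ≥0∞}
    (hκ : κ ≠ ∞)
    (hF : ∀ u, ∃ w : ℝ≥0∞, w ^ 2 ≤ κ * meanSquareIncrement r u ∧ ‖u - F u‖ₑ ≤ w + η * ‖u‖ₑ)
    {σ : ℝ≥0∞} (hσ0 : σ ≠ 0) (hσ : σ ≠ ∞) :
    ∫⁻ t, ∫⁻ u, ‖u - F u‖ₑ ∂(μ.at_time t : Measure (L2x d)) ∂(timeMeasure T) ≤
      (σ + η * ENNReal.ofReal M) * ENNReal.ofReal T + c ^ 2 * (κ / σ) := by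
  have hκσ : κ / σ ≠ ∞ := ENNReal.div_ne_top hκ hσ0
  -- lower integrals: only constants are split off, so the increment need not be measurable in `u`
  have hin : ∀ᵐ t ∂(timeMeasure T), ∫⁻ u, ‖u - F u‖ₑ ∂(μ.at_time t : Measure (L2x d)) ≤
      (σ + η * ENNReal.ofReal M) +
        κ / σ * ∫⁻ u, meanSquareIncrement r u ∂(μ.at_time t : Measure (L2x d)) := by
    filter_upwards [hball] with t ht
    calc ∫⁻ u, ‖u - F u‖ₑ ∂(μ.at_time t : Measure (L2x d))
        ≤ ∫⁻ u, ((σ + η * ENNReal.ofReal M) + κ / σ * meanSquareIncrement r u)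
            ∂(μ.at_time t : Measure (L2x d)) := by
          refine lintegral_mono_ae ?_
          filter_upwards [ae_norm_lt ht] with u hu
          obtain ⟨w, hw, hFw⟩ := hF u
          have h1 := le_add_div_of_sq_le hw hσ0 hσ
          have h2 : ‖u‖ₑ ≤ ENNReal.ofReal M := by
            rw [← ofReal_norm]; exact ENNReal.ofReal_le_ofReal hu.le
          calc ‖u - F u‖ₑ ≤ w + η * ‖u‖ₑ := hFw
            _ ≤ (σ + κ * meanSquareIncrement r u / σ) + η * ENNReal.ofReal M :=
              add_le_add h1 (mul_le_mul_right h2 _)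
            _ = _ := by rw [div_eq_mul_inv, div_eq_mul_inv]; ring
      _ = _ := by
          rw [lintegral_add_left measurable_const, lintegral_const, measure_univ, mul_one,
            lintegral_const_mul' _ _ hκσ]
  refine (lintegral_mono_ae hin).trans ?_
  rw [lintegral_add_left measurable_const, lintegral_const, timeMeasure_univ,
    lintegral_const_mul' _ _ hκσ, mul_comm (κ / σ)]
  gcongr
  exact lintegral_meanSquareIncrement_le hc

/-- At a uniform scale, a single continuous operator that is controlled by `H^{-L}` and has totally
bounded values on balls approximates the identity for the whole family. -/
theorem exists_uniform_smoothing {ι : Type*} {μ : ι → TimeParamMeasure d T} (L : ℝ) {M : ℝ}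
    (hball : ∀ Δ, ∀ᵐ t ∂(timeMeasure T),
      ((μ Δ).at_time t : Measure (L2x d)) {u : L2x d | ‖u‖ < M} = 1)
    {ω : ℝ≥0 → ℝ≥0} (hω : IsModulusOfContinuity ω)
    (hstruct : ∀ Δ, ∀ r : ℝ≥0, 0 < r → structureFunction (μ Δ) (r : ℝ) ≤ (ω r : ℝ≥0∞))
    {τ : ℝ≥0∞} (hτ : 0 < τ) :
    ∃ F : L2x d →ₗ[ℝ] L2x d, Continuous F ∧
      (∀ Δ, ∫⁻ t, ∫⁻ u, ‖u - F u‖ₑ ∂((μ Δ).at_time t : Measure (L2x d)) ∂(timeMeasure T) ≤ τ) ∧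
      (∃ C : ℝ≥0∞, C ≠ ∞ ∧ ∀ u, ‖F u‖ₑ ≤ C * negSobolevNorm L u) ∧
      TotallyBounded (range fun u : Metric.ball (0 : L2x d) M => F u.1) := by
  have hτ3 : τ / 3 ≠ 0 := (ENNReal.div_pos hτ.ne' (by simp)).ne'
  obtain ⟨σ, hσ, hστ⟩ := ENNReal.exists_nnreal_pos_mul_lt (a := ENNReal.ofReal T)
    ENNReal.ofReal_ne_top hτ3
  obtain ⟨η, hη, hητ⟩ := ENNReal.exists_nnreal_pos_mul_lt
    (a := ENNReal.ofReal M * ENNReal.ofReal T)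
    (ENNReal.mul_ne_top ENNReal.ofReal_ne_top ENNReal.ofReal_ne_top) hτ3
  have hσ0 : (σ : ℝ≥0∞) ≠ 0 := by exact_mod_cast hσ.ne'
  set κ : ℝ≥0∞ := 4 * 2 ^ d with hκ
  have hκt : κ ≠ ∞ := ENNReal.mul_ne_top (by simp) (by simp)
  obtain ⟨r, hr, hrτ⟩ : ∃ r : ℝ≥0, 0 < r ∧ (ω r : ℝ≥0∞) ^ 2 * (κ / σ) < τ / 3 := by
    have h1 : Tendsto (fun r => (ω r : ℝ≥0∞) ^ 2 * (κ / σ)) (𝓝[≠] 0) (𝓝 0) := by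
      have h2 : Tendsto (fun r => (ω r : ℝ≥0∞) ^ 2) (𝓝[≠] 0) (𝓝 0) := by
        have := ((ENNReal.continuous_pow 2).tendsto 0).comp (ENNReal.tendsto_coe.2 hω)
        simpa [Function.comp_def] using this
      simpa using ENNReal.Tendsto.mul_const h2 (Or.inr (ENNReal.div_ne_top hκt hσ0))
    obtain ⟨r, hr, hr0⟩ := ((h1.eventually_lt_const (pos_iff_ne_zero.2 hτ3)).and
      self_mem_nhdsWithin).exists
    exact ⟨r, pos_iff_ne_zero.2 hr0, hr⟩
  obtain ⟨F, hF, hF1, hF2, hF3⟩ := exists_smoothing d L M (r := r) (by exact_mod_cast hr)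
    (η := η) (by exact_mod_cast hη)
  refine ⟨F, hF, fun Δ => ?_, hF2, hF3⟩
  refine (lintegral_displacement_le (hball Δ) (hstruct Δ r hr) hκt hF1 hσ0
    ENNReal.coe_ne_top).trans ?_
  rw [ENNReal.ofReal_coe_nnreal, add_mul, mul_assoc]
  calc (σ : ℝ≥0∞) * ENNReal.ofReal T + η * (ENNReal.ofReal M * ENNReal.ofReal T) +
        (ω r : ℝ≥0∞) ^ 2 * (κ / σ) ≤ τ / 3 + τ / 3 + τ / 3 := by gcongr
    _ = τ := ENNReal.add_thirds τ

/-- Time-regularity allows a discretisation in time: within each of the `m` time steps there is a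
time at which the law, discretised by the simple function `D`, is close to the smoothed laws at
almost all other times of the step. -/
theorem exists_times {μ : TimeParamMeasure d T} {L C₀ M : ℝ}
    (hreg : IsTimeRegularWith μ L C₀) (hC₀ : 0 < C₀)
    (hball : ∀ᵐ t ∂(timeMeasure T), (μ.at_time t : Measure (L2x d)) {u | ‖u‖ < M} = 1)
    {F : L2x d →ₗ[ℝ] L2x d} (hF : Measurable F) {C : ℝ≥0∞} (hC : C ≠ ∞)
    (hFC : ∀ u, ‖F u‖ₑ ≤ C * negSobolevNorm L u) {D : SimpleFunc (L2x d) (L2x d)} {τ : ℝ≥0∞}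
    (hD : ∀ u ∈ Metric.ball (0 : L2x d) M, edist (F u) (D u) ≤ τ)
    {m : ℕ} {h : ℝ} (hh : 0 < h) (hm : m * h = T) :
    ∃ s : Fin m → ℝ, ∀ᵐ t ∂(timeMeasure T), ∀ j : Fin m, t ∈ Ico ((j : ℝ) * h) ((j + 1) * h) →
      edist (pushLaw (μ.at_time t) hF) (pushLaw (μ.at_time (s j)) D.measurable) ≤
        C * ENNReal.ofReal (C₀ * h) + τ := by
  obtain ⟨π, hπ⟩ := hreg
  have hgood := (Measure.ae_ae_of_ae_prod hπ).and hball
  have hex : ∀ j : Fin m, ∃ s ∈ Ico ((j : ℝ) * h) ((j + 1) * h),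
      (∀ᵐ t ∂(timeMeasure T), IsTransferPlan (π s t) (μ.at_time s) (μ.at_time t) ∧
        ∫⁻ q, negSobolevNorm L (q.1 - q.2) ∂(π s t : Measure (L2x d × L2x d)) ≤
          ENNReal.ofReal (C₀ * |t - s|)) ∧
      (μ.at_time s : Measure (L2x d)) {u | ‖u‖ < M} = 1 := by
    intro j
    have hsub : Ico ((j : ℝ) * h) ((j + 1) * h) ⊆ Ico 0 T := by
      refine Ico_subset_Ico (by positivity) ?_
      rw [← hm]
      have : (j : ℝ) + 1 ≤ m := by exact_mod_cast j.2
      gcongr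
    have hres : (timeMeasure T).restrict (Ico ((j : ℝ) * h) ((j + 1) * h)) =
        volume.restrict (Ico ((j : ℝ) * h) ((j + 1) * h)) := by
      rw [timeMeasure, Measure.restrict_restrict measurableSet_Ico, inter_eq_left.2 hsub]
    have hpos : volume (Ico ((j : ℝ) * h) ((j + 1) * h)) ≠ 0 := by
      rw [Real.volume_Ico, ← sub_mul]
      simpa using hh
    refine Measure.exists_mem_of_measure_ne_zero_of_ae hpos ?_
    rw [← hres]
    exact ae_restrict_of_ae hgood
  choose s hs hsπ hsM using hex
  refine ⟨s, ?_⟩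
  have hall : ∀ᵐ t ∂(timeMeasure T), ∀ j, IsTransferPlan (π (s j) t) (μ.at_time (s j))
      (μ.at_time t) ∧ ∫⁻ q, negSobolevNorm L (q.1 - q.2) ∂(π (s j) t : Measure (L2x d × L2x d)) ≤
        ENNReal.ofReal (C₀ * |t - s j|) := ae_all_iff.2 hsπ
  filter_upwards [hall] with t ht j htj
  have habs : |t - s j| ≤ h := by
    have := hs j
    rw [abs_le]
    constructor <;> linarith [this.1, this.2, htj.1, htj.2]
  obtain ⟨hplan, hcost⟩ := ht j
  refine (edist_triangle _ (pushLaw (μ.at_time (s j)) hF) _).trans (add_le_add ?_ ?_)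
  · rw [edist_comm]
    refine (edist_pushLaw_le_of_plan hplan hF).trans ?_
    calc ∫⁻ q, ‖F q.1 - F q.2‖ₑ ∂(π (s j) t : Measure (L2x d × L2x d))
        ≤ ∫⁻ q, C * negSobolevNorm L (q.1 - q.2) ∂(π (s j) t : Measure (L2x d × L2x d)) := by
          refine lintegral_mono fun q => ?_
          rw [← map_sub]
          exact hFC _
      _ = C * ∫⁻ q, negSobolevNorm L (q.1 - q.2) ∂(π (s j) t : Measure (L2x d × L2x d)) :=
          lintegral_const_mul' _ _ hC
      _ ≤ C * ENNReal.ofReal (C₀ * h) := by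
          refine mul_le_mul_right (hcost.trans (ENNReal.ofReal_le_ofReal ?_)) _
          gcongr
  · refine (edist_pushLaw_le _ hF D.measurable).trans ?_
    calc ∫⁻ u, ‖F u - D u‖ₑ ∂(μ.at_time (s j) : Measure (L2x d))
        ≤ ∫⁻ _, τ ∂(μ.at_time (s j) : Measure (L2x d)) := by
          refine lintegral_mono_ae ?_
          filter_upwards [ae_norm_lt (hsM j)] with u hu
          rw [← edist_eq_enorm_sub]
          exact hD u (mem_ball_zero_iff.2 hu)
      _ = τ := by simp

/-- A uniformly time-regular family on a common ball, with a uniform bound on the structure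
functions, is totally bounded for `d_T`: the code of a member is the tuple of its discretised
laws at the selected times. -/
theorem totallyBounded_range_toL1P {ι : Type*} {μ : ι → TimeParamMeasure d T} (hT : 0 < T)
    (hreg : UniformlyTimeRegular μ) {M : ℝ}
    (hball : ∀ Δ, ∀ᵐ t ∂(timeMeasure T),
      ((μ Δ).at_time t : Measure (L2x d)) {u : L2x d | ‖u‖ < M} = 1)
    {ω : ℝ≥0 → ℝ≥0} (hω : IsModulusOfContinuity ω)
    (hstruct : ∀ Δ, ∀ r : ℝ≥0, 0 < r → structureFunction (μ Δ) (r : ℝ) ≤ (ω r : ℝ≥0∞)) :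
    TotallyBounded (range fun Δ => (μ Δ).toL1P) := by
  obtain ⟨L, C₀, -, hC₀, hreg⟩ := hreg
  refine totallyBounded_range_of_codes fun ε hε => ?_
  obtain ⟨τ, hτ, hτε⟩ := ENNReal.exists_nnreal_pos_mul_lt (a := 2 + 5 * ENNReal.ofReal T)
    (ENNReal.add_ne_top.2 ⟨by simp, ENNReal.mul_ne_top (by simp) ENNReal.ofReal_ne_top⟩) hε.ne'
  have hτ' : (0 : ℝ≥0∞) < τ := by exact_mod_cast hτ
  obtain ⟨F, hFc, hFτ, ⟨C, hC, hFC⟩, hFb⟩ := exists_uniform_smoothing L hball hω hstruct hτ'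
  have hF : Measurable F := hFc.measurable
  obtain ⟨D, hD⟩ := exists_simpleFunc_edist_le hF hFb hτ'
  -- a time step so short that the smoothed laws move by at most `τ` during it
  obtain ⟨m, hm0, hm⟩ : ∃ m : ℕ, 0 < m ∧ C * ENNReal.ofReal (C₀ * (T / m)) ≤ τ := by
    have h1 : Tendsto (fun m : ℕ => C₀ * (T / m)) atTop (𝓝 0) := by
      simpa using (tendsto_const_div_atTop_nhds_zero_nat T).const_mul C₀
    have h2 : Tendsto (fun m : ℕ => C * ENNReal.ofReal (C₀ * (T / m))) atTop (𝓝 0) := by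
      simpa using ENNReal.Tendsto.const_mul (ENNReal.tendsto_ofReal h1) (Or.inr hC)
    obtain ⟨m, hm, hm0⟩ := ((h2.eventually_lt_const hτ').and (eventually_gt_atTop 0)).exists
    exact ⟨m, hm0, hm.le⟩
  have hm0' : (0 : ℝ) < m := by exact_mod_cast hm0
  have hh : 0 < T / m := by positivity
  have hmT : m * (T / m) = T := by field_simp
  choose s hs using fun Δ => exists_times (hreg Δ) hC₀ (hball Δ) hF hC hFC hD hh hmT
  refine ⟨Fin m → WassersteinSpace (L2x d), inferInstance,
    fun Δ j => pushLaw ((μ Δ).at_time (s Δ j)) D.measurable, ?_, τ, hτ', fun Δ Δ' hc => ?_⟩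
  · refine (isCompact_univ_pi fun _ : Fin m => isCompact_range (continuous_discreteLaw
      (fun i : D.range => i.1))).totallyBounded.subset ?_
    rintro _ ⟨Δ, rfl⟩ j -
    exact ⟨simpleWeights D _, (pushLaw_simpleFunc D _).symm⟩
  · rw [edist_toL1P]
    refine lt_of_le_of_lt ?_ hτε
    have hIco : ∀ᵐ t ∂(timeMeasure T), t ∈ Ico 0 T := ae_restrict_mem measurableSet_Ico
    have hpt : ∀ᵐ t ∂(timeMeasure T),
        wasserstein1 ((μ Δ).at_time t) ((μ Δ').at_time t) ≤
          ∫⁻ u, ‖u - F u‖ₑ ∂((μ Δ).at_time t : Measure (L2x d)) +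
            (∫⁻ u, ‖u - F u‖ₑ ∂((μ Δ').at_time t : Measure (L2x d)) + 5 * τ) := by
      filter_upwards [hs Δ, hs Δ', hIco] with t ht ht' htT
      have hfl : ⌊t / (T / m)⌋₊ < m := by
        rw [Nat.floor_lt (div_nonneg htT.1 hh.le), div_lt_iff₀ hh, hmT]
        exact htT.2
      have htj : t ∈ Ico ((⌊t / (T / m)⌋₊ : ℝ) * (T / m)) ((⌊t / (T / m)⌋₊ + 1) * (T / m)) :=
        ⟨by rw [← le_div_iff₀ hh]; exact Nat.floor_le (div_nonneg htT.1 hh.le),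
          by rw [← div_lt_iff₀ hh]; exact Nat.lt_floor_add_one _⟩
      set j : Fin m := ⟨⌊t / (T / m)⌋₊, hfl⟩
      have h1 := (ht j htj).trans (add_le_add_left hm _)
      have h2 := (ht' j htj).trans (add_le_add_left hm _)
      rw [edist_comm] at h2
      have h3 := (edist_le_pi_edist (fun j => pushLaw ((μ Δ).at_time (s Δ j)) D.measurable)
        (fun j => pushLaw ((μ Δ').at_time (s Δ' j)) D.measurable) j).trans hc.le
      have h4 := edist_self_pushLaw_le ((μ Δ).at_time t) hF
      have h5 := edist_self_pushLaw_le ((μ Δ').at_time t) hF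
      rw [edist_comm] at h5
      rw [← edist_toWasserstein]
      -- the five errors `τ`: twice the time step, twice the discretisation of `F`, once the code
      have hmid := (edist_triangle4 _ _ _ _).trans (add_le_add (add_le_add h1 h3) h2)
      refine (edist_triangle4 _ _ _ _).trans ((add_le_add (add_le_add h4 hmid) h5).trans_eq ?_)
      ring
    refine (lintegral_mono_ae hpt).trans ?_
    have hmeas : ∀ Δ, AEMeasurable
        (fun t => ∫⁻ u, ‖u - F u‖ₑ ∂((μ Δ).at_time t : Measure (L2x d))) (timeMeasure T) :=
      fun Δ => (μ Δ).aemeasurable_lintegral (by fun_prop)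
    rw [lintegral_add_left' (hmeas Δ), lintegral_add_left' (hmeas Δ'), lintegral_const,
      timeMeasure_univ]
    refine (add_le_add (hFτ Δ) (add_le_add (hFτ Δ') le_rfl)).trans_eq ?_
    ring

end FinalArgument

end StatSol

theorem mainTheorem3 (d : ℕ) (hd : d = 2 ∨ d = 3) (T : ℝ) (hT : 0 < T)
    (μ : Set.Ioi (0 : ℝ) → TimeParamMeasure d T)
    (hreg : UniformlyTimeRegular μ)
    (hball : ∃ M : ℝ, 0 < M ∧ ∀ Δ, ∀ᵐ t ∂(timeMeasure T),
      ((μ Δ).at_time t : Measure (L2x d)) {u : L2x d | ‖u‖ < M} = 1)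
    (hstruct : ∃ ω : ℝ≥0 → ℝ≥0, IsModulusOfContinuity ω ∧
      ∀ Δ, ∀ r : ℝ≥0, 0 < r → structureFunction (μ Δ) (r : ℝ) ≤ (ω r : ℝ≥0∞)) :
    RelativelyCompact (Set.range fun Δ => (μ Δ).toL1P) := by
  obtain ⟨M, -, hM⟩ := hball
  obtain ⟨ω, hω, hS⟩ := hstruct
  exact (totallyBounded_range_toL1P hT hreg hM hω hS).closure.isCompact_of_isClosed
    isClosed_closure
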